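/- Let $\Bbbk$ be a field of characteristic $0$. Let $W$ be the Witt algebra over $\Bbbk$, i.e. the Lie algebra with basis $\{e_n\}_{n\in\mathbb Z}$ and bracket $[e_n,e_m]=(m-n)e_{n+m}$, let $W_+$ be its Lie subalgebra generated by $\{e_n\}_{n\ge 1}$, and let $U(W_+)$ be the universal enveloping algebra of $W_+$, graded by $\deg e_n=n$. Let $$S=\Bbbk\langle u,v,w\rangle/(uv-vu-v^2,\ uw-wu-vw,\ vw-wv),\qquad R=\Bbbk\langle u,v\rangle/(uv-vu-v^2),$$ where $R=\bigoplus_{n\ge 0}R_n$ is graded by $\deg u=\deg v=1$, and put $R_{\ge n}=\bigoplus_{m\ge n}R_m$. Let $\phi:U(W_+)\to S$ and, for $a\in\Bbbk$, $\lambda_a:U(W_+)\to R$ be the $\Bbbk$-algebra homomorphisms determined by $$\phi(e_n)=(u-(n-1)w)v^{n-1},\qquad \lambda_a(e_n)=(u-(n-1)av)v^{n-1}\qquad(n\ge 1).$$ Below, $(x_1,\dots,x_r)$ denotes the two-sided ideal generated by $x_1,\dots,x_r$, and noetherian means left and right noetherian. Then the following hold. (a) If $a\in\{0,1\}$, then $\ker\lambda_a=(e_1e_3-e_2^2-e_4)$.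 If $a\ne 0,1$, then $\ker\lambda_a=(h_1,h_2,h_3)$, where \begin{align*} h_1&=e_1e_2^2-e_1^2e_3-2a\,e_2e_3+(1+2a)e_1e_4-(a^2+a)e_5,\\ h_2&=e_1e_5-4e_2e_4+3e_3^2+2e_6,\\ h_3&=-4e_1^2e_2^2-4e_2^3+4e_1^3e_3+(20a^2+14a-7)e_3^2-(16a^2+18a+5)e_1e_5+(16a^3+36a^2+16a-2)e_6, \end{align*} and $h_1$ is homogeneous of degree $5$, while $h_2$ and $h_3$ are homogeneous of degree $6$. (b) $\lambda_0(U(W_+))=\Bbbk+uR$, $\lambda_1(U(W_+))=\Bbbk+Ru$, and $\lambda_a(U(W_+))\supseteq R_{\ge 4}$ if $a\ne 0,1$. For every $a\in\Bbbk$, the ring $\lambda_a(U(W_+))$ is noetherian. (c) $\ker\phi=(e_1e_5-4e_2e_4+3e_3^2+2e_6)$. -/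

import Mathlib

/-! ### The Witt algebra and its positive part -/

/-- The underlying vector space of the Witt algebra, with basis `e n`, `n : ℤ`. -/
def Witt (k : Type*) [Field k] : Type _ := ℤ →₀ k

namespace Witt

noncomputable section

variable (k : Type*) [Field k]

instance : AddCommGroup (Witt k) := inferInstanceAs (AddCommGroup (ℤ →₀ k))

instance : Module k (Witt k) := inferInstanceAs (Module k (ℤ →₀ k))

/-- The basis `e n`, `n : ℤ`, of the Witt algebra. -/
def basis : Module.Basis ℤ k (Witt k) := Module.Basis.ofRepr (LinearEquiv.refl k (ℤ →₀ k))

/-- The basis vector `e n`. -/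
def e (n : ℤ) : Witt k := basis k n

/-- The bilinear map with `(e n, e m) ↦ (m - n) e (n + m)`. -/
def bracket : Witt k →ₗ[k] Witt k →ₗ[k] Witt k :=
  (basis k).constr k fun n => (basis k).constr k fun m => ((m : k) - (n : k)) • e k (n + m)

theorem bracket_e (n m : ℤ) : bracket k (e k n) (e k m) = ((m : k) - (n : k)) • e k (n + m) := by
  simp [bracket, e]

variable {k} in
theorem induction_basis {P : Witt k → Prop} (x : Witt k) (zero : P 0)
    (add : ∀ x y, P x → P y → P (x + y)) (smul : ∀ (c : k) (x), P x → P (c • x))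
    (coe : ∀ n, P (e k n)) : P x := by
  have hx : x ∈ Submodule.span k (Set.range (basis k)) := by simp
  induction hx using Submodule.span_induction with
  | zero => exact zero
  | add x y _ _ hx hy => exact add x y hx hy
  | smul c x _ hx => exact smul c x hx
  | mem x hx =>
    obtain ⟨n, rfl⟩ := hx
    exact coe n

theorem bracket_self (x : Witt k) : bracket k x x = 0 := by
  have hanti : ∀ x y : Witt k, bracket k x y + bracket k y x = 0 := by
    have h : bracket k + (bracket k).flip = 0 := by
      refine (basis k).ext fun n => (basis k).ext fun m => ?_
      change bracket k (e k n) (e k m) + bracket k (e k m) (e k n) = 0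
      rw [bracket_e, bracket_e, add_comm m n, ← add_smul]
      simp
    intro x y
    exact LinearMap.congr_fun (LinearMap.congr_fun h x) y
  induction x using induction_basis with
  | zero => simp
  | coe n =>
    change bracket k (e k n) (e k n) = 0
    rw [bracket_e]
    simp
  | add x y hx hy =>
    have := hanti x y
    simp only [map_add, LinearMap.add_apply, hx, hy, zero_add, add_zero]
    rw [add_comm]
    exact this
  | smul c x hx => simp [hx]

theorem bracket_leibniz (x y z : Witt k) :
    bracket k x (bracket k y z) =
      bracket k (bracket k x y) z + bracket k y (bracket k x z) := by
  induction x using induction_basis with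
  | zero => simp
  | add x x' hx hx' =>
    simp only [map_add, LinearMap.add_apply, hx, hx']
    abel
  | smul c x hx => simp only [map_smul, LinearMap.smul_apply, hx, smul_add]
  | coe n =>
  induction y using induction_basis with
  | zero => simp
  | add x x' hx hx' =>
    simp only [map_add, LinearMap.add_apply, hx, hx']
    abel
  | smul c x hx => simp only [map_smul, LinearMap.smul_apply, hx, smul_add]
  | coe m =>
  induction z using induction_basis with
  | zero => simp
  | add x x' hx hx' =>
    simp only [map_add, hx, hx']
    abel
  | smul c x hx => simp only [map_smul, hx, smul_add]
  | coe l =>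
    simp only [bracket_e, map_smul, LinearMap.smul_apply, smul_smul]
    rw [show m + (n + l) = n + (m + l) by ring, show n + m + l = n + (m + l) by ring, ← add_smul]
    congr 1
    push_cast
    ring

/-- The Witt algebra, with Lie bracket `⁅e n, e m⁆ = (m - n) e (n + m)`. -/
instance : LieRing (Witt k) where
  bracket x y := bracket k x y
  add_lie x y z := by change bracket k (x + y) z = _; rw [map_add]; rfl
  lie_add x y z := by change bracket k x (y + z) = _; rw [map_add]
  lie_self x := bracket_self k x
  leibniz_lie x y z := bracket_leibniz k x y z

instance : LieAlgebra k (Witt k) where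
  lie_smul c x y := by change bracket k x (c • y) = _; rw [map_smul]; rfl

theorem lie_e (n m : ℤ) : ⁅e k n, e k m⁆ = ((m : k) - (n : k)) • e k (n + m) := bracket_e k n m

end

end Witt

/-- The positive Witt algebra `W₊`: the Lie subalgebra of `W` generated by the `e n`, `n ≥ 1`. -/
noncomputable abbrev WittPos (k : Type*) [Field k] : LieSubalgebra k (Witt k) :=
  LieSubalgebra.lieSpan k (Witt k) {x | ∃ n : ℤ, 1 ≤ n ∧ x = Witt.e k n}

namespace WittPos

noncomputable section

variable (k : Type*) [Field k]

/-- The elements `e n`, `n ≥ 1`, of `W₊`. -/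
def e (n : ℕ+) : WittPos k :=
  ⟨Witt.e k (n : ℤ), LieSubalgebra.subset_lieSpan ⟨(n : ℤ), by exact_mod_cast n.pos, rfl⟩⟩

/-- `W₊` is already the linear span of the `e n`, `n ≥ 1`. -/
theorem toSubmodule_eq :
    (WittPos k).toSubmodule = Submodule.span k {x | ∃ n : ℤ, 1 ≤ n ∧ x = Witt.e k n} := by
  set s : Set (Witt k) := {x | ∃ n : ℤ, 1 ≤ n ∧ x = Witt.e k n} with hs
  have hlie : ∀ x ∈ Submodule.span k s, ∀ y ∈ Submodule.span k s, ⁅x, y⁆ ∈ Submodule.span k s := by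
    intro x hx y hy
    induction hx using Submodule.span_induction with
    | zero => simp
    | add x x' _ _ h h' => rw [add_lie]; exact add_mem h h'
    | smul c x _ h => rw [smul_lie]; exact Submodule.smul_mem _ _ h
    | mem x hx =>
    induction hy using Submodule.span_induction with
    | zero => simp
    | add x x' _ _ h h' => rw [lie_add]; exact add_mem h h'
    | smul c x _ h => rw [lie_smul]; exact Submodule.smul_mem _ _ h
    | mem y hy =>
      obtain ⟨n, hn, rfl⟩ := hx
      obtain ⟨m, hm, rfl⟩ := hy
      rw [Witt.lie_e]
      exact Submodule.smul_mem _ _ (Submodule.subset_span ⟨n + m, by omega, rfl⟩)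
  apply le_antisymm
  · let K : LieSubalgebra k (Witt k) :=
      { Submodule.span k s with lie_mem' := fun {x y} hx hy => hlie x hx y hy }
    have : WittPos k ≤ K := LieSubalgebra.lieSpan_le.mpr fun x hx => Submodule.subset_span hx
    exact this
  · exact Submodule.span_le.mpr LieSubalgebra.subset_lieSpan

attribute [local instance 100] LieRing.ofAssociativeRing

variable {k} {A : Type*} [Ring A] [Algebra k A]

theorem pow_mul_comm_aux {u v : A} (h : u * v - v * u - v ^ 2 = 0) (j : ℕ) :
    v ^ j * u = u * v ^ j - (j : k) • v ^ (j + 1) := by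
  have h' : v * u = u * v - v ^ 2 := by
    rw [← sub_eq_zero, ← neg_eq_zero, ← h]; abel
  induction j with
  | zero => simp
  | succ j ih =>
    rw [pow_succ, mul_assoc, h', mul_sub, ← mul_assoc, ih, sub_mul, smul_mul_assoc, ← pow_succ,
      ← pow_add, mul_assoc, ← pow_succ]
    push_cast
    rw [add_smul, one_smul]
    abel

/-- If `u, v, w` satisfy the relations of the algebra `S`, then the elements
`(u - (n - 1) w) v ^ (n - 1)` satisfy the relations of the positive Witt algebra. -/
theorem comm_aux {u v w : A} (h₁ : u * v - v * u - v ^ 2 = 0) (h₂ : u * w - w * u - v * w = 0)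
    (h₃ : v * w - w * v = 0) (i j : ℕ) :
    (u - (i : k) • w) * v ^ i * ((u - (j : k) • w) * v ^ j)
      - (u - (j : k) • w) * v ^ j * ((u - (i : k) • w) * v ^ i)
      = ((j : k) - (i : k)) • ((u - ((i : k) + j + 1) • w) * v ^ (i + j + 1)) := by
  have hvw : Commute v w := sub_eq_zero.mp h₃
  have hwu : w * u = u * w - w * v := by
    rw [← hvw.eq, ← sub_eq_zero, ← neg_eq_zero, ← h₂]; abel
  have key : ∀ i j : ℕ, (u - (i : k) • w) * v ^ i * ((u - (j : k) • w) * v ^ j)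
      = u * u * v ^ (i + j) - (i : k) • (u * v ^ (i + j + 1)) - (j : k) • (u * w * v ^ (i + j))
        - (i : k) • (u * w * v ^ (i + j)) + (i : k) • (w * v ^ (i + j + 1))
        + ((i : k) * i) • (w * v ^ (i + j + 1)) + ((i : k) * j) • (w * w * v ^ (i + j)) := by
    intro i j
    have e₁ : v ^ i * ((u - (j : k) • w) * v ^ j)
        = u * v ^ (i + j) - (i : k) • v ^ (i + j + 1) - (j : k) • (w * v ^ (i + j)) := by
      rw [← mul_assoc, mul_sub, pow_mul_comm_aux (k := k) h₁, mul_smul_comm,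
        (hvw.pow_left i).eq, sub_mul, sub_mul, smul_mul_assoc, smul_mul_assoc, mul_assoc,
        mul_assoc, ← pow_add, ← pow_add, show i + 1 + j = i + j + 1 by ring]
    have e₂ : w * (u * v ^ (i + j)) = u * w * v ^ (i + j) - w * v ^ (i + j + 1) := by
      rw [← mul_assoc, hwu, sub_mul, mul_assoc w v, ← pow_succ']
    rw [mul_assoc, e₁, sub_mul]
    simp only [mul_sub, smul_mul_assoc, mul_smul_comm, e₂, smul_sub, smul_smul]
    simp only [← mul_assoc]
    module
  rw [key i j, key j i, add_comm j i]
  simp only [sub_mul, smul_sub, smul_mul_assoc, smul_smul]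
  module

variable (k) in
/-- For `u, v, w` in a `k`-algebra that satisfy the relations of the algebra `S`, the Lie algebra
map from `W₊` with `e n ↦ (u - (n - 1) w) v ^ (n - 1)`. It is the restriction to `W₊` of a linear
map on `W`, whose values on `e n`, `n ≤ 0`, do not matter. -/
def lieHom (u v w : A) (h₁ : u * v - v * u - v ^ 2 = 0) (h₂ : u * w - w * u - v * w = 0)
    (h₃ : v * w - w * v = 0) : WittPos k →ₗ⁅k⁆ A :=
  let F : Witt k →ₗ[k] A :=
    (Witt.basis k).constr k fun n : ℤ => (u - ((n : k) - 1) • w) * v ^ (n - 1).toNat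
  { F.comp (WittPos k).toSubmodule.subtype with
    map_lie' := by
      have hF : ∀ n : ℤ, F (Witt.e k n) = (u - ((n : k) - 1) • w) * v ^ (n - 1).toNat :=
        fun n => (Witt.basis k).constr_basis k _ n
      have key : ∀ x ∈ Submodule.span k {x | ∃ n : ℤ, 1 ≤ n ∧ x = Witt.e k n},
          ∀ y ∈ Submodule.span k {x | ∃ n : ℤ, 1 ≤ n ∧ x = Witt.e k n},
          F ⁅x, y⁆ = F x * F y - F y * F x := by
        intro x hx y hy
        induction hx using Submodule.span_induction with
        | zero => simp
        | add x x' _ _ h h' => rw [add_lie, map_add, h, h', map_add, add_mul, mul_add]; abel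
        | smul c x _ h => rw [smul_lie, map_smul, h, map_smul, smul_sub]; simp
        | mem x hx =>
        induction hy using Submodule.span_induction with
        | zero => simp
        | add x x' _ _ h h' => rw [lie_add, map_add, h, h', map_add, add_mul, mul_add]; abel
        | smul c x _ h => rw [lie_smul, map_smul, h, map_smul, smul_sub]; simp
        | mem y hy =>
          obtain ⟨n, hn, rfl⟩ := hx
          obtain ⟨m, hm, rfl⟩ := hy
          obtain ⟨i, rfl⟩ : ∃ i : ℕ, n = i + 1 := ⟨(n - 1).toNat, by omega⟩
          obtain ⟨j, rfl⟩ : ∃ j : ℕ, m = j + 1 := ⟨(m - 1).toNat, by omega⟩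
          have hc := comm_aux (k := k) h₁ h₂ h₃ i j
          rw [Witt.lie_e, map_smul, hF, hF, hF,
            show ((i : ℤ) + 1 - 1).toNat = i by omega,
            show ((j : ℤ) + 1 - 1).toNat = j by omega,
            show ((i : ℤ) + 1 + ((j : ℤ) + 1) - 1).toNat = i + j + 1 by omega]
          push_cast
          simp only [add_sub_cancel_right, add_sub_add_right_eq_sub]
          rw [hc, show (i : k) + 1 + (j + 1) - 1 = i + j + 1 by ring]
      intro x y
      exact key _ (by rw [← toSubmodule_eq]; exact x.2) _ (by rw [← toSubmodule_eq]; exact y.2) }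

theorem lieHom_e (u v w : A) (h₁ : u * v - v * u - v ^ 2 = 0) (h₂ : u * w - w * u - v * w = 0)
    (h₃ : v * w - w * v = 0) (n : ℕ+) :
    lieHom k u v w h₁ h₂ h₃ (e k n) = (u - (((n : ℕ) : k) - 1) • w) * v ^ ((n : ℕ) - 1) := by
  have : lieHom k u v w h₁ h₂ h₃ (e k n)
      = (u - ((((n : ℕ) : ℤ) : k) - 1) • w) * v ^ (((n : ℕ) : ℤ) - 1).toNat :=
    (Witt.basis k).constr_basis k _ _
  rw [this, Int.cast_natCast, show (((n : ℕ) : ℤ) - 1).toNat = (n : ℕ) - 1 by omega]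

end

end WittPos

/-! ### The algebras `R` and `S` -/

/-- The defining relation of the Jordan plane, with `u = ι 0` and `v = ι 1`. -/
inductive JordanRel (k : Type*) [Field k] : FreeAlgebra k (Fin 2) → FreeAlgebra k (Fin 2) → Prop
  | uv : JordanRel k (FreeAlgebra.ι k 0 * FreeAlgebra.ι k 1 - FreeAlgebra.ι k 1 * FreeAlgebra.ι k 0
      - FreeAlgebra.ι k 1 ^ 2) 0

/-- The Jordan plane `R = k⟨u, v⟩ / (uv - vu - v²)`. -/
def JordanPlane (k : Type*) [Field k] : Type _ := RingQuot (JordanRel k)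

noncomputable instance (k : Type*) [Field k] : Ring (JordanPlane k) :=
  inferInstanceAs (Ring (RingQuot (JordanRel k)))

noncomputable instance (k : Type*) [Field k] : Algebra k (JordanPlane k) :=
  inferInstanceAs (Algebra k (RingQuot (JordanRel k)))

/-- The defining relations of `S`, with `u = ι 0`, `v = ι 1` and `w = ι 2`. -/
inductive SRel (k : Type*) [Field k] : FreeAlgebra k (Fin 3) → FreeAlgebra k (Fin 3) → Prop
  | uv : SRel k (FreeAlgebra.ι k 0 * FreeAlgebra.ι k 1 - FreeAlgebra.ι k 1 * FreeAlgebra.ι k 0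
      - FreeAlgebra.ι k 1 ^ 2) 0
  | uw : SRel k (FreeAlgebra.ι k 0 * FreeAlgebra.ι k 2 - FreeAlgebra.ι k 2 * FreeAlgebra.ι k 0
      - FreeAlgebra.ι k 1 * FreeAlgebra.ι k 2) 0
  | vw : SRel k (FreeAlgebra.ι k 1 * FreeAlgebra.ι k 2 - FreeAlgebra.ι k 2 * FreeAlgebra.ι k 1) 0

/-- The algebra `S = k⟨u, v, w⟩ / (uv - vu - v², uw - wu - vw, vw - wv)`. -/
def SAlg (k : Type*) [Field k] : Type _ := RingQuot (SRel k)

noncomputable instance (k : Type*) [Field k] : Ring (SAlg k) :=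
  inferInstanceAs (Ring (RingQuot (SRel k)))

noncomputable instance (k : Type*) [Field k] : Algebra k (SAlg k) :=
  inferInstanceAs (Algebra k (RingQuot (SRel k)))

namespace JordanPlane

noncomputable section

variable (k : Type*) [Field k]

/-- The quotient map from the free algebra. -/
def mk : FreeAlgebra k (Fin 2) →ₐ[k] JordanPlane k := RingQuot.mkAlgHom k (JordanRel k)

theorem mk_rel {x : FreeAlgebra k (Fin 2)} (h : JordanRel k x 0) : mk k x = 0 :=
  (RingQuot.mkAlgHom_rel k h).trans (map_zero (mk k))

/-- The generator `u` of the Jordan plane. -/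
def u : JordanPlane k := mk k (FreeAlgebra.ι k 0)

/-- The generator `v` of the Jordan plane. -/
def v : JordanPlane k := mk k (FreeAlgebra.ι k 1)

theorem rel_uv : u k * v k - v k * u k - v k ^ 2 = 0 := by
  simpa [u, v] using mk_rel k JordanRel.uv

/-- The component `R_n` of the grading of `R` with `deg u = deg v = 1`: the span of the products
of `n` generators. -/
def gradedPart (n : ℕ) : Submodule k (JordanPlane k) := Submodule.span k {u k, v k} ^ n

/-- `R_{≥ n}`, the sum of the `R_m` with `m ≥ n`. -/
def gradedPartGE (n : ℕ) : Submodule k (JordanPlane k) := ⨆ m ≥ n, gradedPart k m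

end

end JordanPlane

namespace SAlg

noncomputable section

variable (k : Type*) [Field k]

/-- The quotient map from the free algebra. -/
def mk : FreeAlgebra k (Fin 3) →ₐ[k] SAlg k := RingQuot.mkAlgHom k (SRel k)

theorem mk_rel {x : FreeAlgebra k (Fin 3)} (h : SRel k x 0) : mk k x = 0 :=
  (RingQuot.mkAlgHom_rel k h).trans (map_zero (mk k))

/-- The generator `u` of `S`. -/
def u : SAlg k := mk k (FreeAlgebra.ι k 0)

/-- The generator `v` of `S`. -/
def v : SAlg k := mk k (FreeAlgebra.ι k 1)

/-- The generator `w` of `S`. -/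
def w : SAlg k := mk k (FreeAlgebra.ι k 2)

theorem rel_uv : u k * v k - v k * u k - v k ^ 2 = 0 := by
  simpa [u, v] using mk_rel k SRel.uv

theorem rel_uw : u k * w k - w k * u k - v k * w k = 0 := by
  simpa [u, v, w] using mk_rel k SRel.uw

theorem rel_vw : v k * w k - w k * v k = 0 := by
  simpa [v, w] using mk_rel k SRel.vw

end

end SAlg

/-! ### The enveloping algebra `U(W₊)` and the maps `φ` and `λ_a` -/

/-- The universal enveloping algebra `U(W₊)`. -/
abbrev UWittPos (k : Type*) [Field k] : Type _ := UniversalEnvelopingAlgebra k (WittPos k)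

namespace UWittPos

noncomputable section

variable (k : Type*) [Field k]

/-- The generators `e n`, `n ≥ 1`, of `U(W₊)`. -/
def e (n : ℕ+) : UWittPos k := UniversalEnvelopingAlgebra.ι k (WittPos.e k n)

/-- The component `U(W₊)_d` of the grading of `U(W₊)` with `deg (e n) = n`: the span of the
products `e i₁ ⋯ e iᵣ` with `i₁ + ⋯ + iᵣ = d`. -/
def gradedPart (d : ℕ) : Submodule k (UWittPos k) :=
  Submodule.span k {x | ∃ l : List ℕ+, (l.map fun n => (n : ℕ)).sum = d ∧ x = (l.map (e k)).prod}

/-- The algebra map `φ : U(W₊) → S` with `φ (e n) = (u - (n - 1) w) v ^ (n - 1)`. -/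
def phi : UWittPos k →ₐ[k] SAlg k :=
  UniversalEnvelopingAlgebra.lift k
    (WittPos.lieHom k (SAlg.u k) (SAlg.v k) (SAlg.w k)
      (SAlg.rel_uv k) (SAlg.rel_uw k) (SAlg.rel_vw k))

theorem phi_e (n : ℕ+) :
    phi k (e k n) = (SAlg.u k - (((n : ℕ) : k) - 1) • SAlg.w k) * SAlg.v k ^ ((n : ℕ) - 1) := by
  rw [phi, e, UniversalEnvelopingAlgebra.lift_ι_apply, WittPos.lieHom_e]

variable {k}

/-- The algebra map `λ_a : U(W₊) → R` with `λ_a (e n) = (u - (n - 1) a v) v ^ (n - 1)`. -/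
def lam (a : k) : UWittPos k →ₐ[k] JordanPlane k :=
  UniversalEnvelopingAlgebra.lift k
    (WittPos.lieHom k (JordanPlane.u k) (JordanPlane.v k) (a • JordanPlane.v k)
      (JordanPlane.rel_uv k)
      (by
        rw [mul_smul_comm, smul_mul_assoc, mul_smul_comm, ← smul_sub, ← smul_sub, ← sq,
          JordanPlane.rel_uv, smul_zero])
      (by rw [mul_smul_comm, smul_mul_assoc, sub_self]))

theorem lam_e (a : k) (n : ℕ+) :
    lam a (e k n) = (JordanPlane.u k - ((((n : ℕ) : k) - 1) * a) • JordanPlane.v k)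
      * JordanPlane.v k ^ ((n : ℕ) - 1) := by
  rw [lam, e, UniversalEnvelopingAlgebra.lift_ι_apply, WittPos.lieHom_e, smul_smul]

/-- `h₁ = e₁e₂² - e₁²e₃ - 2a e₂e₃ + (1 + 2a) e₁e₄ - (a² + a) e₅`. -/
def h₁ (a : k) : UWittPos k :=
  e k 1 * e k 2 ^ 2 - e k 1 ^ 2 * e k 3 - (2 * a) • (e k 2 * e k 3)
    + (1 + 2 * a) • (e k 1 * e k 4) - (a ^ 2 + a) • e k 5

variable (k) in
/-- `h₂ = e₁e₅ - 4 e₂e₄ + 3 e₃² + 2 e₆`. -/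
def h₂ : UWittPos k :=
  e k 1 * e k 5 - 4 * (e k 2 * e k 4) + 3 * e k 3 ^ 2 + 2 * e k 6

/-- `h₃ = -4 e₁²e₂² - 4 e₂³ + 4 e₁³e₃ + (20a² + 14a - 7) e₃² - (16a² + 18a + 5) e₁e₅
+ (16a³ + 36a² + 16a - 2) e₆`. -/
def h₃ (a : k) : UWittPos k :=
  -(4 * (e k 1 ^ 2 * e k 2 ^ 2)) - 4 * e k 2 ^ 3 + 4 * (e k 1 ^ 3 * e k 3)
    + (20 * a ^ 2 + 14 * a - 7) • e k 3 ^ 2 - (16 * a ^ 2 + 18 * a + 5) • (e k 1 * e k 5)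
    + (16 * a ^ 3 + 36 * a ^ 2 + 16 * a - 2) • e k 6

end

end UWittPos

/-! ### Families satisfying the relations of the positive Witt algebra -/

/-- A family `E i`, thought of as `e (i + 1)`, that satisfies the relations of `W₊`. -/
def IsWittFamily (k : Type*) [Field k] {A : Type*} [Ring A] [Algebra k A] (E : ℕ → A) : Prop :=
  ∀ i j : ℕ, E i * E j - E j * E i = ((j : k) - i) • E (i + j + 1)

/-- The symmetrized product of two members of a family. -/
def symProd {A : Type*} [Ring A] (E : ℕ → A) (i j : ℕ) : A := E i * E j + E j * E i

/-- The quadratic element `Z t`, of degree `t + 4`, that measures how far the symmetrized products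
of that degree are from being equal. -/
noncomputable def quadZ (k : Type*) [Field k] {A : Type*} [Ring A] [Algebra k A] (E : ℕ → A)
    (t : ℕ) : A :=
  (2 * ((t : k) + 1))⁻¹ • (symProd E 1 (t + 1) - symProd E 0 (t + 2))

theorem symProd_comm {A : Type*} [Ring A] (E : ℕ → A) (i j : ℕ) :
    symProd E i j = symProd E j i := add_comm _ _

theorem map_symProd {A B F : Type*} [Ring A] [Ring B] [FunLike F A B] [RingHomClass F A B]
    (f : F) (E : ℕ → A) (i j : ℕ) : f (symProd E i j) = symProd (fun i => f (E i)) i j := by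
  simp [symProd]

namespace IsWittFamily

variable {k : Type*} [Field k] {A : Type*} [Ring A] [Algebra k A] {E : ℕ → A}

theorem comp {B : Type*} [Ring B] [Algebra k B] (hE : IsWittFamily k E) (f : A →ₐ[k] B) :
    IsWittFamily k fun i => f (E i) := fun i j => by
  rw [← map_mul, ← map_mul, ← map_sub, hE, map_smul]

theorem comm_symProd (hE : IsWittFamily k E) (m i j : ℕ) :
    E m * symProd E i j - symProd E i j * E m
      = ((i : k) - m) • symProd E (m + i + 1) j + ((j : k) - m) • symProd E i (m + j + 1) := by
  have h : E m * symProd E i j - symProd E i j * E m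
      = (E m * E i - E i * E m) * E j + E j * (E m * E i - E i * E m)
        + (E i * (E m * E j - E j * E m) + (E m * E j - E j * E m) * E i) := by
    unfold symProd; noncomm_ring
  rw [h, hE, hE]
  simp only [symProd, smul_mul_assoc, mul_smul_comm, smul_add]

variable (k) in
theorem two_smul_mul (hE : IsWittFamily k E) (i j : ℕ) :
    (2 : k) • (E i * E j) = symProd E i j + ((j : k) - i) • E (i + j + 1) := by
  rw [← hE, symProd, two_smul]; abel

variable [CharZero k]

theorem mul_eq (hE : IsWittFamily k E) (i j : ℕ) :
    E i * E j = (2 : k)⁻¹ • (symProd E i j + ((j : k) - i) • E (i + j + 1)) := by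
  rw [← hE.two_smul_mul, smul_smul, inv_mul_cancel₀ two_ne_zero, one_smul]

variable (k E) in
theorem smul_quadZ (t : ℕ) :
    (2 * ((t : k) + 1)) • quadZ k E t = symProd E 1 (t + 1) - symProd E 0 (t + 2) := by
  rw [quadZ, smul_smul, mul_inv_cancel₀, one_smul]
  exact mul_ne_zero two_ne_zero (Nat.cast_add_one_ne_zero t)

/-- If `e₁e₃ - e₂² - e₄ = 0`, then the symmetrized products depend only on the degree. -/
theorem symProd_eq_of_degFour (hE : IsWittFamily k E) (h : E 0 * E 2 - E 1 ^ 2 - E 3 = 0) :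
    ∀ s i j : ℕ, i + j = s → symProd E i j = symProd E 0 s := by
  intro s
  induction s using Nat.strong_induction_on with
  | _ s ih =>
  match s with
  | 0 => intro i j hij; obtain ⟨rfl, rfl⟩ : i = 0 ∧ j = 0 := by omega
         rfl
  | 1 =>
    intro i j hij
    rcases i with _ | i
    · obtain rfl : j = 1 := by omega
      rfl
    · obtain ⟨rfl, rfl⟩ : i = 0 ∧ j = 0 := by omega
      exact symProd_comm ..
  | 2 =>
    have h2 : symProd E 1 1 = symProd E 0 2 := by
      have h1 := hE 0 2
      norm_num at h1
      have h' : E 3 = E 0 * E 2 - E 1 ^ 2 := by rw [← sub_eq_zero, ← neg_eq_zero, ← h]; abel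
      have h3 : E 2 * E 0 = E 0 * E 2 - (2 : k) • E 3 := by rw [← h1]; abel
      rw [symProd, symProd, h3, h', two_smul, sq]
      abel
    intro i j hij
    obtain ⟨rfl, rfl⟩ | ⟨rfl, rfl⟩ | ⟨rfl, rfl⟩ :
        (i = 0 ∧ j = 2) ∨ (i = 1 ∧ j = 1) ∨ (i = 2 ∧ j = 0) := by omega
    · rfl
    · exact h2
    · exact symProd_comm ..
  | s + 3 =>
    have r₁ : ∀ i j, i + j = s + 2 → (i : k) • symProd E (i + 1) j + (j : k) • symProd E i (j + 1)
        = ((s : k) + 2) • symProd E 0 (s + 3) := by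
      intro i j hij
      have e₁ := hE.comm_symProd 0 i j
      have e₂ := hE.comm_symProd 0 0 (s + 2)
      rw [ih (s + 2) (by omega) i j hij] at e₁
      rw [e₁] at e₂
      simpa [add_assoc] using e₂
    have r₂ := hE.comm_symProd 1 1 s
    rw [ih (s + 1) (by omega) 1 s (by omega), hE.comm_symProd 1 0 (s + 1)] at r₂
    have r₁' := r₁ 1 (s + 1) (by omega)
    have b : symProd E 1 (s + 2) = symProd E 0 (s + 3) := by
      rw [← sub_eq_zero, ← smul_eq_zero_iff_right (two_ne_zero (α := k))]
      norm_num [show 1 + s + 1 = s + 2 by ring, show 1 + (s + 1) + 1 = s + 3 by ring] at r₂ r₁'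
      linear_combination (norm := module) r₁' + r₂
    intro i
    induction i with
    | zero => intro j hj; obtain rfl : j = s + 3 := by omega
              rfl
    | succ i ihi =>
      intro j hij
      rcases i with _ | i
      · obtain rfl : j = s + 2 := by omega
        exact b
      · have r := r₁ (i + 1) j (by omega)
        rw [ihi (j + 1) (by omega)] at r
        have hs : (s : k) + 2 = i + 1 + j := by
          exact_mod_cast congrArg (Nat.cast (R := k)) (show s + 2 = i + 1 + j by omega)
        rw [hs, ← sub_eq_zero] at r
        rw [← sub_eq_zero, ← smul_eq_zero_iff_right (Nat.cast_add_one_ne_zero (R := k) i), ← r]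
        push_cast
        module

/-- If `e₁e₅ - 4e₂e₄ + 3e₃² + 2e₆ = 0`, then the symmetrized products `e i ∘ e j` of a given degree
are a quadratic function of `i`. -/
theorem symProd_eq_of_degSix (hE : IsWittFamily k E)
    (h : E 0 * E 4 - 4 * (E 1 * E 3) + 3 * E 2 ^ 2 + 2 * E 5 = 0) :
    ∀ t i j : ℕ, i + j = t + 2 →
      symProd E i j = symProd E 0 (t + 2) + (2 * (i : k) * j) • quadZ k E t := by
  intro t
  have hZ : ∀ t, symProd E 1 (t + 1) = symProd E 0 (t + 2) + (2 * ((t : k) + 1)) • quadZ k E t :=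
    fun t => by rw [smul_quadZ]; abel
  induction t using Nat.strong_induction_on with
  | _ t ih =>
  match t with
  | 0 =>
    intro i j hij
    obtain ⟨rfl, rfl⟩ | ⟨rfl, rfl⟩ | ⟨rfl, rfl⟩ :
        (i = 0 ∧ j = 2) ∨ (i = 1 ∧ j = 1) ∨ (i = 2 ∧ j = 0) := by omega
    · simp
    · simpa using hZ 0
    · simpa using symProd_comm E 2 0
  | 1 =>
    intro i j hij
    obtain ⟨rfl, rfl⟩ | ⟨rfl, rfl⟩ | ⟨rfl, rfl⟩ | ⟨rfl, rfl⟩ :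
      (i = 0 ∧ j = 3) ∨ (i = 1 ∧ j = 2) ∨ (i = 2 ∧ j = 1) ∨ (i = 3 ∧ j = 0) := by omega
    · simp
    · have := hZ 1
      norm_num at this ⊢
      exact this
    · have := hZ 1
      rw [symProd_comm E 2 1]
      norm_num at this ⊢
      exact this
    · simpa using symProd_comm E 3 0
  | 2 =>
    have h2 : symProd E 2 2 = symProd E 0 4 + (8 : k) • quadZ k E 2 := by
      have z := hZ 2
      have e₁ := hE.two_smul_mul k 0 4
      have e₂ := hE.two_smul_mul k 1 3
      have e₃ := hE.two_smul_mul k 2 2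
      have h' : E 0 * E 4 - (4 : k) • (E 1 * E 3) + (3 : k) • (E 2 * E 2) + (2 : k) • E 5 = 0 := by
        rw [← h]
        simp only [Algebra.smul_def, map_ofNat, sq]
      norm_num at z e₁ e₂ e₃
      have h3 : (3 : k) ≠ 0 := three_ne_zero
      rw [← sub_eq_zero, ← smul_eq_zero_iff_right h3]
      linear_combination (norm := module) (2 : k) • h' - e₁ + (4 : k) • e₂ - (3 : k) • e₃
        + (4 : k) • z
    intro i j hij
    have z := hZ 2
    norm_num at z
    obtain ⟨rfl, rfl⟩ | ⟨rfl, rfl⟩ | ⟨rfl, rfl⟩ | ⟨rfl, rfl⟩ | ⟨rfl, rfl⟩ :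
      (i = 0 ∧ j = 4) ∨ (i = 1 ∧ j = 3) ∨ (i = 2 ∧ j = 2) ∨ (i = 3 ∧ j = 1) ∨ (i = 4 ∧ j = 0) := by
        omega
    · simp
    · norm_num; exact z
    · norm_num; exact h2
    · rw [symProd_comm E 3 1]; norm_num; exact z
    · simpa using symProd_comm E 4 0
  | t + 3 =>
    have ht : ∀ n : ℕ, (t : k) + (n + 1) ≠ 0 := fun n => by
      exact_mod_cast Nat.cast_add_one_ne_zero (R := k) (t + n)
    have ht1 : (t : k) + 1 ≠ 0 := Nat.cast_add_one_ne_zero t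
    have ht2 : (t : k) + 2 ≠ 0 := by have := ht 1; norm_num at this; exact this
    have ht3 : (t : k) + 3 ≠ 0 := by have := ht 2; norm_num at this; exact this
    have ht4 : (t : k) + 4 ≠ 0 := by have := ht 3; norm_num at this; exact this
    -- the commutator of `e₁` with the relation in degree one less
    have r₁ : ∀ i j, i + j = t + 4 →
        ((t : k) + 3) • ((i : k) • symProd E (i + 1) j + (j : k) • symProd E i (j + 1))
        = (((t : k) + 3) * (t + 4)) • symProd E 0 (t + 5)
          + ((i : k) * j) • (symProd E 2 (t + 3) + ((t : k) + 3) • symProd E 1 (t + 4)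
              - ((t : k) + 4) • symProd E 0 (t + 5)) := by
      intro i j hij
      have e₀ := hE.comm_symProd 0 i j
      have e₁ := hE.comm_symProd 0 0 (t + 4)
      have e₂ := hE.comm_symProd 0 1 (t + 3)
      rw [ih (t + 2) (by omega) i j hij] at e₀
      rw [hZ (t + 2)] at e₂
      norm_num [mul_add, add_mul, mul_smul_comm, smul_mul_assoc, add_assoc] at e₀ e₁ e₂
      linear_combination (norm := module) (-(t : k) - 3) • e₀ + ((t : k) + 3 - i * j) • e₁
        + ((i : k) * j) • e₂
    have r₂ : ((t : k) + 2) • (symProd E 4 (t + 1) + (t : k) • symProd E 2 (t + 3))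
        = ((t : k) + 2) • (-symProd E 2 (t + 3) + ((t : k) + 2) • symProd E 0 (t + 5))
          + (2 * ((t : k) + 1)) • (((t : k) + 1) • symProd E 1 (t + 4) + symProd E 2 (t + 3)
              - ((t : k) + 2) • symProd E 0 (t + 5)) := by
      have e₀ := hE.comm_symProd 1 2 (t + 1)
      have e₁ := hE.comm_symProd 1 0 (t + 3)
      have e₂ := hE.comm_symProd 1 1 (t + 2)
      rw [ih (t + 1) (by omega) 2 (t + 1) (by omega)] at e₀
      rw [hZ (t + 1)] at e₂
      rw [show 1 + (t + 1) + 1 = t + 3 by ring] at e₀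
      rw [show 1 + (t + 3) + 1 = t + 5 by ring] at e₁
      rw [show 1 + (t + 2) + 1 = t + 4 by ring] at e₂
      norm_num [mul_add, add_mul, mul_smul_comm, smul_mul_assoc] at e₀ e₁ e₂
      linear_combination (norm := module) (-(t : k) - 2) • e₀ + ((t : k) + 2 - 2 * (t + 1)) • e₁
        + (2 * ((t : k) + 1)) • e₂
    have r₃ := r₁ 2 (t + 2) (by omega)
    have r₄ := r₁ 3 (t + 1) (by omega)
    have c : symProd E 2 (t + 3)
        = symProd E 0 (t + 5) + (2 * ((2 : ℕ) : k) * ((t + 3 : ℕ) : k)) • quadZ k E (t + 3) := by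
      have z := hZ (t + 3)
      have hK : ((t : k) + 1) * (t + 4) * (t ^ 2 + 7 * t + 4) ≠ 0 :=
        mul_ne_zero (mul_ne_zero ht1 ht4)
          (by exact_mod_cast (by positivity : t ^ 2 + 7 * t + 4 ≠ 0))
      rw [← sub_eq_zero, ← smul_eq_zero_iff_right hK]
      push_cast at r₃ r₄ z ⊢
      linear_combination (norm := module) (6 * ((t : k) + 3)) • r₂ - (2 * ((t : k) + 2)) • r₄
        + (((t : k) + 1) * (t + 2)) • r₃ + (2 * ((t : k) + 1) * (t + 3) * (t ^ 2 + 7 * t + 4)) • z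
    intro i
    induction i with
    | zero => intro j hj; obtain rfl : j = t + 5 := by omega
              simp
    | succ i ihi =>
      intro j hij
      rcases i with _ | i
      · obtain rfl : j = t + 4 := by omega
        have := hZ (t + 3)
        push_cast at this ⊢
        rw [show t + 3 + 1 = t + 4 by ring, show t + 3 + 2 = t + 5 by ring] at *
        rw [this]
        module
      · have r := r₁ (i + 1) j (by omega)
        have z := hZ (t + 3)
        rw [ihi (j + 1) (by omega), c] at r
        have hi : (i : k) = t + 3 - j := by
          rw [eq_sub_iff_add_eq]
          exact_mod_cast congrArg (Nat.cast (R := k)) (show i + j = t + 3 by omega)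
        have hK : ((t : k) + 3) * (i + 1) ≠ 0 := mul_ne_zero ht3 (Nat.cast_add_one_ne_zero i)
        rw [← sub_eq_zero, ← smul_eq_zero_iff_right hK]
        push_cast at r z ⊢
        rw [hi] at r ⊢
        linear_combination (norm := module) r + (((t : k) + 3 - j + 1) * j * (t + 3)) • z

end IsWittFamily

/-- The element `e (n + 1) Z - (a² - a) e - (t + 4) a Z` of degree `n + t + 5`, which vanishes
under `λ_a`. -/
noncomputable def cubicRel {k : Type*} [Field k] {A : Type*} [Ring A] [Algebra k A] (E : ℕ → A)
    (a : k) (n t : ℕ) : A :=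
  E n * quadZ k E t - (a ^ 2 - a) • E (n + t + 4) - (((t : k) + 4) * a) • quadZ k E (n + t + 1)

theorem map_quadZ {k : Type*} [Field k] {A B : Type*} [Ring A] [Algebra k A] [Ring B] [Algebra k B]
    (f : A →ₐ[k] B) (E : ℕ → A) (t : ℕ) :
    f (quadZ k E t) = quadZ k (fun i => f (E i)) t := by
  simp [quadZ, map_symProd]

theorem map_cubicRel {k : Type*} [Field k] {A B : Type*} [Ring A] [Algebra k A] [Ring B]
    [Algebra k B] (f : A →ₐ[k] B) (E : ℕ → A) (a : k) (n t : ℕ) :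
    f (cubicRel E a n t) = cubicRel (fun i => f (E i)) a n t := by
  simp [cubicRel, map_quadZ]

namespace IsWittFamily

variable {k : Type*} [Field k] {A : Type*} [Ring A] [Algebra k A] {E : ℕ → A} [CharZero k]

theorem smul_quadZ_eq (hE : IsWittFamily k E) (t : ℕ) :
    ((t : k) + 1) • quadZ k E t = E 1 * E (t + 1) - E 0 * E (t + 2) + E (t + 3) := by
  have h₀ := smul_quadZ k E t
  have h₁ := hE.two_smul_mul k 1 (t + 1)
  have h₂ := hE.two_smul_mul k 0 (t + 2)
  rw [show 1 + (t + 1) + 1 = t + 3 by ring] at h₁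
  rw [show 0 + (t + 2) + 1 = t + 3 by ring] at h₂
  push_cast at h₁ h₂
  rw [← sub_eq_zero, ← smul_eq_zero_iff_right (two_ne_zero (α := k))]
  linear_combination (norm := module) h₀ - h₁ + h₂

theorem comm_quadZ (hE : IsWittFamily k E)
    (h : E 0 * E 4 - 4 * (E 1 * E 3) + 3 * E 2 ^ 2 + 2 * E 5 = 0) (m t : ℕ) :
    E m * quadZ k E t - quadZ k E t * E m = ((t : k) + 4) • quadZ k E (m + t + 1) := by
  have hq := hE.symProd_eq_of_degSix h (m + t + 1)
  have e₁ := hE.comm_symProd m 1 (t + 1)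
  have e₀ := hE.comm_symProd m 0 (t + 2)
  rw [hq (m + 1 + 1) (t + 1) (by omega), hq 1 (m + (t + 1) + 1) (by omega)] at e₁
  rw [hq (m + 0 + 1) (t + 2) (by omega), show m + (t + 2) + 1 = m + t + 1 + 2 by ring] at e₀
  have hK : 2 * ((t : k) + 1) ≠ 0 := mul_ne_zero two_ne_zero (Nat.cast_add_one_ne_zero t)
  rw [← sub_eq_zero, ← smul_eq_zero_iff_right hK]
  have z : (2 * ((t : k) + 1)) • (E m * quadZ k E t - quadZ k E t * E m)
      = E m * (symProd E 1 (t + 1) - symProd E 0 (t + 2))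
        - (symProd E 1 (t + 1) - symProd E 0 (t + 2)) * E m := by
    rw [← smul_quadZ k E t]
    simp only [mul_smul_comm, smul_mul_assoc, smul_sub]
  rw [mul_sub, sub_mul] at z
  push_cast at e₀ e₁
  linear_combination (norm := module) z + e₁ - e₀

theorem comm_cubicRel (hE : IsWittFamily k E)
    (h : E 0 * E 4 - 4 * (E 1 * E 3) + 3 * E 2 ^ 2 + 2 * E 5 = 0) (a : k) (m n t : ℕ) :
    E m * cubicRel E a n t - cubicRel E a n t * E m
      = ((n : k) - m) • cubicRel E a (m + n + 1) t
        + ((t : k) + 4) • cubicRel E a n (m + t + 1) := by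
  have e₁ := hE m n
  have e₂ := hE.comm_quadZ h m t
  have e₃ := hE m (n + t + 4)
  have e₄ := hE.comm_quadZ h m (n + t + 1)
  have e₅ : E m * (E n * quadZ k E t) - E n * quadZ k E t * E m
      = (E m * E n - E n * E m) * quadZ k E t
        + E n * (E m * quadZ k E t - quadZ k E t * E m) := by noncomm_ring
  rw [e₁, e₂] at e₅
  simp only [cubicRel, mul_sub, sub_mul, smul_mul_assoc, mul_smul_comm] at e₅ ⊢
  rw [show m + (n + t + 4) + 1 = m + n + t + 5 by ring] at e₃
  rw [show m + (n + t + 1) + 1 = m + n + t + 2 by ring] at e₄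
  rw [show m + n + 1 + t + 4 = m + n + t + 5 by ring,
    show n + (m + t + 1) + 4 = m + n + t + 5 by ring,
    show m + n + 1 + t + 1 = m + n + t + 2 by ring,
    show n + (m + t + 1) + 1 = m + n + t + 2 by ring]
  push_cast at e₃ e₄ ⊢
  linear_combination (norm := module) e₅ - (a ^ 2 - a) • e₃ - (((t : k) + 4) * a) • e₄

theorem cubicRel_eq_zero (hE : IsWittFamily k E)
    (h : E 0 * E 4 - 4 * (E 1 * E 3) + 3 * E 2 ^ 2 + 2 * E 5 = 0) (a : k)
    (h₀ : cubicRel E a 0 0 = 0) (h₁ : cubicRel E a 1 0 = 0) (n t : ℕ) :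
    cubicRel E a n t = 0 := by
  have ht : ∀ t : ℕ, (t : k) + 4 ≠ 0 := fun t => by
    exact_mod_cast Nat.cast_add_one_ne_zero (R := k) (t + 3)
  have r₀ : ∀ t, cubicRel E a 0 t = 0 := by
    intro t
    induction t with
    | zero => exact h₀
    | succ t ih =>
      have := hE.comm_cubicRel h a 0 0 t
      rw [ih] at this
      simpa [ht t] using this.symm
  have r₂ : ∀ t, cubicRel E a 2 t = 0 := by
    intro t
    have := hE.comm_cubicRel h a 1 0 t
    rw [r₀, r₀] at this
    simpa using this
  have r₁ : ∀ t, cubicRel E a 1 t = 0 := by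
    intro t
    induction t with
    | zero => exact h₁
    | succ t ih =>
      have := hE.comm_cubicRel h a 0 1 t
      rw [ih, r₂] at this
      simpa [ht t] using this.symm
  induction n generalizing t with
  | zero => exact r₀ t
  | succ n ih =>
    rcases n with _ | n
    · exact r₁ t
    have := hE.comm_cubicRel h a 0 (n + 1) t
    rw [ih, ih] at this
    simpa [Nat.cast_add_one_ne_zero (R := k) n] using this.symm

theorem cubicRel_zero_zero (hE : IsWittFamily k E) (a : k) :
    cubicRel E a 0 0 = E 0 * E 1 ^ 2 - E 0 ^ 2 * E 2 - (2 * a) • (E 1 * E 2)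
      + (1 + 2 * a) • (E 0 * E 3) - (a ^ 2 + a) • E 4 := by
  have z₀ := hE.smul_quadZ_eq 0
  have z₁ := hE.smul_quadZ_eq 1
  norm_num at z₀ z₁
  rw [cubicRel, z₀]
  simp only [mul_add, mul_sub, sq, mul_assoc, zero_add]
  push_cast
  linear_combination (norm := module) (-(2 * a)) • z₁

theorem degSix_eq_cubicRel (hE : IsWittFamily k E) (a : k) :
    -(4 * (E 0 ^ 2 * E 1 ^ 2)) - 4 * E 1 ^ 3 + 4 * (E 0 ^ 3 * E 2)
      + (20 * a ^ 2 + 14 * a - 7) • E 2 ^ 2 - (16 * a ^ 2 + 18 * a + 5) • (E 0 * E 4)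
      + (16 * a ^ 3 + 36 * a ^ 2 + 16 * a - 2) • E 5
    = -((4 : k) • (E 0 * cubicRel E a 0 0)) - (4 : k) • cubicRel E a 1 0
      - (16 * a + 8) • cubicRel E a 0 1
      + ((20 * a ^ 2 + 14 * a - 3) / 3) •
        (E 0 * E 4 - 4 * (E 1 * E 3) + 3 * E 2 ^ 2 + 2 * E 5) := by
  have z₀ := hE.smul_quadZ_eq 0
  have z₁ := hE.smul_quadZ_eq 1
  have z₂ := hE.smul_quadZ_eq 2
  norm_num at z₀ z₁ z₂
  have z₁' := congrArg (E 0 * ·) z₁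
  have c₁ := congrArg (· * E 2) (hE 1 0)
  rw [hE.cubicRel_zero_zero, cubicRel, cubicRel, z₀]
  have four : ∀ x : A, 4 * x = (4 : k) • x := fun x => by
    rw [Algebra.smul_def, map_ofNat]
  have three : ∀ x : A, 3 * x = (3 : k) • x := fun x => by
    rw [Algebra.smul_def, map_ofNat]
  have two : ∀ x : A, 2 * x = (2 : k) • x := fun x => by
    rw [Algebra.smul_def, map_ofNat]
  simp only [mul_add, mul_sub, sub_mul, pow_succ, pow_zero, one_mul, mul_assoc, zero_add,
    four, three, two, mul_smul_comm, smul_mul_assoc] at z₁' c₁ ⊢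
  norm_num at c₁ z₁' ⊢
  linear_combination (norm := module) (8 * a + 4) • z₁' - ((80 * a ^ 2 + 56 * a) / 3) • z₂
    - (4 : k) • c₁

end IsWittFamily

/-! ### Normal forms -/

/-- The normal forms `e₁ⁱ` and `e₁ⁱ e (n + 2)`. -/
def nfDegFour {A : Type*} [Ring A] (E : ℕ → A) : ℕ ⊕ ℕ × ℕ → A :=
  Sum.elim (fun i => E 0 ^ i) fun p => E 0 ^ p.1 * E (p.2 + 1)

/-- The normal forms `e₁ⁱ`, `e₁ⁱ e (n + 2)` and `Z t`. -/
noncomputable def nfCubic (k : Type*) [Field k] {A : Type*} [Ring A] [Algebra k A] (E : ℕ → A) :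
    (ℕ ⊕ ℕ × ℕ) ⊕ ℕ → A :=
  Sum.elim (nfDegFour E) (quadZ k E)

/-- The normal forms `e₁ⁱ e₂ʲ` and `e₁ⁱ e₂ʲ e (n + 3)`. -/
def nfDegSix {A : Type*} [Ring A] (E : ℕ → A) : ℕ × ℕ ⊕ ℕ × ℕ × ℕ → A :=
  Sum.elim (fun p => E 0 ^ p.1 * E 1 ^ p.2) fun p => E 0 ^ p.1 * E 1 ^ p.2.1 * E (p.2.2 + 2)

namespace IsWittFamily

variable {k : Type*} [Field k] {A : Type*} [Ring A] [Algebra k A] {E : ℕ → A}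

theorem mul_pow_mul_mem (hE : IsWittFamily k E) {N : Submodule k A} (h₀ : ∀ y ∈ N, E 0 * y ∈ N)
    {y : A} (hy : ∀ m, E m * y ∈ N) (i m : ℕ) : E m * (E 0 ^ i * y) ∈ N := by
  induction i generalizing m with
  | zero => simpa using hy m
  | succ i ih =>
    have h : E m * (E 0 ^ (i + 1) * y) = E 0 * (E m * (E 0 ^ i * y))
        + (E m * E 0 - E 0 * E m) * (E 0 ^ i * y) := by
      rw [pow_succ']; noncomm_ring
    rw [h, hE, smul_mul_assoc]
    exact add_mem (h₀ _ (ih m)) (N.smul_mem _ (ih _))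

theorem span_mul_mem {ι : Type*} {f : ι → A} {x : A}
    (h : ∀ i, x * f i ∈ Submodule.span k (Set.range f)) :
    ∀ y ∈ Submodule.span k (Set.range f), x * y ∈ Submodule.span k (Set.range f) := by
  intro y hy
  induction hy using Submodule.span_induction with
  | zero => simp
  | add y z _ _ hy hz => rw [mul_add]; exact add_mem hy hz
  | smul c y _ hy => rw [mul_smul_comm]; exact Submodule.smul_mem _ c hy
  | mem y hy => obtain ⟨i, rfl⟩ := hy; exact h i

theorem nfDegFour_mem_inl (i : ℕ) : E 0 ^ i ∈ Submodule.span k (Set.range (nfDegFour E)) :=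
  Submodule.subset_span ⟨Sum.inl i, rfl⟩

theorem nfDegFour_mem (i n : ℕ) :
    E 0 ^ i * E n ∈ Submodule.span k (Set.range (nfDegFour E)) := by
  rcases n with _ | n
  · rw [← pow_succ]; exact nfDegFour_mem_inl (i + 1)
  · exact Submodule.subset_span ⟨Sum.inr (i, n), rfl⟩

variable [CharZero k]

theorem nfDegFour_mul_mem (hE : IsWittFamily k E) (h : E 0 * E 2 - E 1 ^ 2 - E 3 = 0) (m : ℕ) :
    ∀ y ∈ Submodule.span k (Set.range (nfDegFour E)),
      E m * y ∈ Submodule.span k (Set.range (nfDegFour E)) := by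
  set N := Submodule.span k (Set.range (nfDegFour E))
  have h₀ : ∀ y ∈ N, E 0 * y ∈ N := by
    refine span_mul_mem ?_
    rintro (i | ⟨i, n⟩)
    · change E 0 * E 0 ^ i ∈ _
      rw [← pow_succ']; exact nfDegFour_mem_inl _
    · change E 0 * (E 0 ^ i * E (n + 1)) ∈ _
      rw [← mul_assoc, ← pow_succ']; exact nfDegFour_mem _ _
  have hs : ∀ n, E n ∈ N := fun n => by simpa using nfDegFour_mem (k := k) (E := E) 0 n
  refine span_mul_mem ?_
  rintro (i | ⟨i, n⟩)
  · have := hE.mul_pow_mul_mem h₀ (y := 1) (fun m => by simpa using hs m) i m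
    rwa [mul_one] at this
  · refine hE.mul_pow_mul_mem h₀ (fun m => ?_) i m
    rw [hE.mul_eq, hE.symProd_eq_of_degFour h _ m (n + 1) rfl,
      ← sub_eq_iff_eq_add.mpr (hE.two_smul_mul k 0 (m + (n + 1)))]
    exact N.smul_mem _ (add_mem (sub_mem (N.smul_mem _ (h₀ _ (hs _))) (N.smul_mem _ (hs _)))
      (N.smul_mem _ (hs _)))

theorem nfCubic_mul_mem (hE : IsWittFamily k E)
    (h : E 0 * E 4 - 4 * (E 1 * E 3) + 3 * E 2 ^ 2 + 2 * E 5 = 0) {a : k}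
    (h₀ : cubicRel E a 0 0 = 0) (h₁ : cubicRel E a 1 0 = 0) (m : ℕ) :
    ∀ y ∈ Submodule.span k (Set.range (nfCubic k E)),
      E m * y ∈ Submodule.span k (Set.range (nfCubic k E)) := by
  set N := Submodule.span k (Set.range (nfCubic k E))
  have hle : Submodule.span k (Set.range (nfDegFour E)) ≤ N :=
    Submodule.span_mono (by rintro _ ⟨i, rfl⟩; exact ⟨Sum.inl i, rfl⟩)
  have hZ : ∀ t, quadZ k E t ∈ N := fun t => Submodule.subset_span ⟨Sum.inr t, rfl⟩
  have hs : ∀ n, E n ∈ N := fun n => hle (by simpa using nfDegFour_mem (k := k) (E := E) 0 n)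
  have hmZ : ∀ m t, E m * quadZ k E t ∈ N := by
    intro m t
    have := hE.cubicRel_eq_zero h a h₀ h₁ m t
    rw [cubicRel, sub_sub, sub_eq_zero] at this
    rw [this]
    exact add_mem (N.smul_mem _ (hs _)) (N.smul_mem _ (hZ _))
  have h₀ : ∀ y ∈ N, E 0 * y ∈ N := by
    refine span_mul_mem ?_
    rintro ((i | ⟨i, n⟩) | t)
    · change E 0 * E 0 ^ i ∈ _
      rw [← pow_succ']; exact hle (nfDegFour_mem_inl _)
    · change E 0 * (E 0 ^ i * E (n + 1)) ∈ _
      rw [← mul_assoc, ← pow_succ']; exact hle (nfDegFour_mem _ _)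
    · exact hmZ 0 t
  refine span_mul_mem ?_
  rintro ((i | ⟨i, n⟩) | t)
  · have := hE.mul_pow_mul_mem h₀ (y := 1) (fun m => by simpa using hs m) i m
    rwa [mul_one] at this
  · refine hE.mul_pow_mul_mem h₀ (fun m => ?_) i m
    rcases m with _ | m
    · exact h₀ _ (hs _)
    rw [hE.mul_eq, hE.symProd_eq_of_degSix h (m + n) (m + 1) (n + 1) (by ring),
      ← sub_eq_iff_eq_add.mpr (hE.two_smul_mul k 0 (m + n + 2))]
    exact N.smul_mem _ (add_mem (add_mem (sub_mem (N.smul_mem _ (h₀ _ (hs _)))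
      (N.smul_mem _ (hs _))) (N.smul_mem _ (hZ _))) (N.smul_mem _ (hs _)))
  · exact hmZ m t

end IsWittFamily

/-- The span of `1` and the members of a family. -/
def lengthLEOne (k : Type*) [Field k] {A : Type*} [Ring A] [Algebra k A] (E : ℕ → A) :
    Submodule k A :=
  Submodule.span k (insert 1 (Set.range E))

/-- The span of the normal forms `e₁ⁱ e₂ʲ` and `e₁ⁱ e₂ʲ e (n + 3)` of length at most `r`. -/
def nfDegSixLE (k : Type*) [Field k] {A : Type*} [Ring A] [Algebra k A] (E : ℕ → A) (r : ℕ) :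
    Submodule k A :=
  Submodule.span k ({x | ∃ i j, i + j ≤ r ∧ x = E 0 ^ i * E 1 ^ j}
    ∪ {x | ∃ i j n, i + j + 1 ≤ r ∧ x = E 0 ^ i * E 1 ^ j * E (n + 2)})

namespace IsWittFamily

variable {k : Type*} [Field k] {A : Type*} [Ring A] [Algebra k A] {E : ℕ → A}

variable (k E) in
theorem mem_lengthLEOne (n : ℕ) : E n ∈ lengthLEOne k E :=
  Submodule.subset_span (Or.inr ⟨n, rfl⟩)

variable (k E) in
theorem one_le_lengthLEOne : 1 ≤ lengthLEOne k E := by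
  rw [Submodule.one_le]; exact Submodule.subset_span (Or.inl rfl)

theorem comm_mem_pow (hE : IsWittFamily k E) (m r : ℕ) :
    ∀ x ∈ lengthLEOne k E ^ r, E m * x - x * E m ∈ lengthLEOne k E ^ r := by
  have h1 : ∀ x ∈ lengthLEOne k E, E m * x - x * E m ∈ lengthLEOne k E := by
    intro x hx
    induction hx using Submodule.span_induction with
    | zero => simp
    | add y z _ _ hy hz =>
      rw [mul_add, add_mul, add_sub_add_comm]; exact add_mem hy hz
    | smul c y _ hy =>
      rw [mul_smul_comm, smul_mul_assoc, ← smul_sub]; exact Submodule.smul_mem _ c hy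
    | mem y hy =>
      obtain rfl | ⟨n, rfl⟩ := hy
      · simp
      · rw [hE]; exact Submodule.smul_mem _ _ (mem_lengthLEOne k E _)
  induction r with
  | zero =>
    intro x hx
    rw [pow_zero, Submodule.mem_one] at hx
    obtain ⟨c, rfl⟩ := hx
    rw [← Algebra.commutes, sub_self]; exact zero_mem _
  | succ r ih =>
    intro x hx
    rw [pow_succ'] at hx ⊢
    induction hx using Submodule.mul_induction_on' with
    | add y _ z _ hy hz => rw [mul_add, add_mul, add_sub_add_comm]; exact add_mem hy hz
    | mem_mul_mem y hy z hz =>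
      have : E m * (y * z) - y * z * E m = (E m * y - y * E m) * z + y * (E m * z - z * E m) := by
        noncomm_ring
      rw [this]
      exact add_mem (Submodule.mul_mem_mul (h1 y hy) hz) (Submodule.mul_mem_mul hy (ih z hz))

variable (k E) in
theorem pow_mul_pow_mem (i j : ℕ) : E 0 ^ i * E 1 ^ j ∈ lengthLEOne k E ^ (i + j) := by
  rw [pow_add]
  exact Submodule.mul_mem_mul (Submodule.pow_mem_pow _ (mem_lengthLEOne k E 0) i)
    (Submodule.pow_mem_pow _ (mem_lengthLEOne k E 1) j)

theorem nfDegSixLE_mono : Monotone (nfDegSixLE k E) := by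
  intro r s hrs
  refine Submodule.span_mono (Set.union_subset_union ?_ ?_)
  · rintro _ ⟨i, j, h, rfl⟩; exact ⟨i, j, h.trans hrs, rfl⟩
  · rintro _ ⟨i, j, n, h, rfl⟩; exact ⟨i, j, n, h.trans hrs, rfl⟩

theorem nfDegSixLE_mem {r i j : ℕ} (n : ℕ) (h : i + j + 1 ≤ r) :
    E 0 ^ i * E 1 ^ j * E (n + 1) ∈ nfDegSixLE k E r := by
  rcases n with _ | n
  · rw [mul_assoc, ← pow_succ]
    exact Submodule.subset_span (Or.inl ⟨i, j + 1, h, rfl⟩)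
  · exact Submodule.subset_span (Or.inr ⟨i, j, n, h, rfl⟩)

theorem pow_le_pow_lengthLEOne {r s : ℕ} (h : r ≤ s) : lengthLEOne k E ^ r ≤ lengthLEOne k E ^ s :=
  pow_le_pow_right₀ (one_le_lengthLEOne k E) h

variable [CharZero k]

theorem pow_le_nfDegSixLE (hE : IsWittFamily k E)
    (h : E 0 * E 4 - 4 * (E 1 * E 3) + 3 * E 2 ^ 2 + 2 * E 5 = 0) (r : ℕ) :
    lengthLEOne k E ^ r ≤ nfDegSixLE k E r := by
  induction r with
  | zero =>
    rw [pow_zero, Submodule.one_le]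
    exact Submodule.subset_span (Or.inl ⟨0, 0, le_rfl, by simp⟩)
  | succ r ih =>
    have hlow : ∀ {s x}, s ≤ r → x ∈ lengthLEOne k E ^ s → x ∈ nfDegSixLE k E (r + 1) :=
      fun hs hx => nfDegSixLE_mono r.le_succ (ih (pow_le_pow_lengthLEOne hs hx))
    have hcomm : ∀ i j, E 0 ^ i * (E 0 * E 1 ^ j - E 1 ^ j * E 0) ∈ lengthLEOne k E ^ (i + j) := by
      intro i j
      rw [pow_add]
      exact Submodule.mul_mem_mul (Submodule.pow_mem_pow _ (mem_lengthLEOne k E 0) i)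
        (hE.comm_mem_pow 0 j _ (Submodule.pow_mem_pow _ (mem_lengthLEOne k E 1) j))
    rw [pow_succ', Submodule.mul_le]
    intro x hx y hy
    replace hy := ih hy
    induction hx using Submodule.span_induction with
    | zero => simp
    | add x z _ _ hx hz => rw [add_mul]; exact add_mem hx hz
    | smul c x _ hx => rw [smul_mul_assoc]; exact Submodule.smul_mem _ c hx
    | mem x hx =>
    obtain rfl | ⟨m, rfl⟩ := hx
    · rw [one_mul]; exact nfDegSixLE_mono r.le_succ hy
    induction hy using Submodule.span_induction with
    | zero => simp
    | add x z _ _ hx hz => rw [mul_add]; exact add_mem hx hz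
    | smul c x _ hx => rw [mul_smul_comm]; exact Submodule.smul_mem _ c hx
    | mem y hy =>
    obtain ⟨i, j, hij, rfl⟩ | ⟨i, j, n, hij, rfl⟩ := hy
    · rw [← sub_add_cancel (E m * (E 0 ^ i * E 1 ^ j)) (E 0 ^ i * E 1 ^ j * E m)]
      refine add_mem (hlow hij (hE.comm_mem_pow m _ _ (pow_mul_pow_mem k E i j))) ?_
      rcases m with _ | m
      · have : E 0 ^ i * E 1 ^ j * E 0
            = E 0 ^ (i + 1) * E 1 ^ j - E 0 ^ i * (E 0 * E 1 ^ j - E 1 ^ j * E 0) := by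
          rw [pow_succ]; noncomm_ring
        rw [this]
        exact sub_mem (Submodule.subset_span (Or.inl ⟨i + 1, j, by omega, rfl⟩))
          (hlow hij (hcomm i j))
      · exact nfDegSixLE_mem m (by omega)
    · set p := E 0 ^ i * E 1 ^ j with hp
      have e₁ : E m * (p * E (n + 2))
          = p * (E m * E (n + 2)) + (E m * p - p * E m) * E (n + 2) := by
        noncomm_ring
      have hpE : ∀ n, p * E n ∈ nfDegSixLE k E (r + 1) := fun n =>
        hlow hij (by
          rw [pow_succ]
          exact Submodule.mul_mem_mul (pow_mul_pow_mem k E i j) (mem_lengthLEOne k E n))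
      have h₀ : p * (E 0 * E (m + n + 2)) ∈ nfDegSixLE k E (r + 1) := by
        have : p * (E 0 * E (m + n + 2)) = E 0 ^ (i + 1) * E 1 ^ j * E (m + n + 2)
            - E 0 ^ i * (E 0 * E 1 ^ j - E 1 ^ j * E 0) * E (m + n + 2) := by
          rw [hp, pow_succ]; noncomm_ring
        rw [this]
        refine sub_mem (nfDegSixLE_mem _ (by omega)) (hlow hij ?_)
        rw [pow_succ]
        exact Submodule.mul_mem_mul (hcomm i j) (mem_lengthLEOne k E _)
      have h₁ : p * (E 1 * E (m + n + 1)) ∈ nfDegSixLE k E (r + 1) := by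
        have : p * (E 1 * E (m + n + 1)) = E 0 ^ i * E 1 ^ (j + 1) * E (m + n + 1) := by
          rw [hp, pow_succ]; noncomm_ring
        rw [this]
        exact nfDegSixLE_mem _ (by omega)
      rw [e₁]
      refine add_mem ?_ (hlow hij (by
        rw [pow_succ]
        exact Submodule.mul_mem_mul (hE.comm_mem_pow m _ _ (pow_mul_pow_mem k E i j))
          (mem_lengthLEOne k E _)))
      rw [hE.mul_eq, hE.symProd_eq_of_degSix h (m + n) m (n + 2) (by ring), quadZ,
        ← sub_eq_iff_eq_add.mpr (hE.two_smul_mul k 0 (m + n + 2)),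
        ← sub_eq_iff_eq_add.mpr (hE.two_smul_mul k 1 (m + n + 1))]
      simp only [mul_smul_comm, mul_add, mul_sub]
      set N := nfDegSixLE k E (r + 1)
      have s₀ := sub_mem (N.smul_mem (2 : k) h₀)
        (N.smul_mem (((m + n + 2 : ℕ) : k) - (0 : ℕ)) (hpE (0 + (m + n + 2) + 1)))
      have s₁ := sub_mem (N.smul_mem (2 : k) h₁)
        (N.smul_mem (((m + n + 1 : ℕ) : k) - (1 : ℕ)) (hpE (1 + (m + n + 1) + 1)))
      exact N.smul_mem _ (add_mem (add_mem s₀ (N.smul_mem _ (N.smul_mem _ (sub_mem s₁ s₀))))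
        (N.smul_mem _ (hpE _)))

theorem nfDegSix_mul_mem (hE : IsWittFamily k E)
    (h : E 0 * E 4 - 4 * (E 1 * E 3) + 3 * E 2 ^ 2 + 2 * E 5 = 0) (m : ℕ) :
    ∀ y ∈ Submodule.span k (Set.range (nfDegSix E)),
      E m * y ∈ Submodule.span k (Set.range (nfDegSix E)) := by
  have key : ∀ r, lengthLEOne k E ^ r ≤ Submodule.span k (Set.range (nfDegSix E)) := by
    refine fun r => (hE.pow_le_nfDegSixLE h r).trans (Submodule.span_mono ?_)
    rintro _ (⟨i, j, -, rfl⟩ | ⟨i, j, n, -, rfl⟩)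
    · exact ⟨Sum.inl (i, j), rfl⟩
    · exact ⟨Sum.inr (i, j, n), rfl⟩
  refine span_mul_mem ?_
  rintro (⟨i, j⟩ | ⟨i, j, n⟩)
  · refine key (i + j + 1) ?_
    rw [pow_succ']
    exact Submodule.mul_mem_mul (mem_lengthLEOne k E m) (pow_mul_pow_mem k E i j)
  · refine key (i + j + 1 + 1) ?_
    rw [pow_succ', pow_succ]
    exact Submodule.mul_mem_mul (mem_lengthLEOne k E m)
      (Submodule.mul_mem_mul (pow_mul_pow_mem k E i j) (mem_lengthLEOne k E _))

end IsWittFamily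

/-! ### Universal properties of `R` and `S` -/

namespace JordanPlane

variable {k : Type*} [Field k] {B : Type*} [Ring B] [Algebra k B]

/-- The algebra map from `R` given by two elements that satisfy the defining relation. -/
noncomputable def lift (x y : B) (h : x * y - y * x - y ^ 2 = 0) : JordanPlane k →ₐ[k] B :=
  RingQuot.liftAlgHom k ⟨FreeAlgebra.lift k ![x, y], by rintro _ _ ⟨⟩; simpa using h⟩

@[simp]
theorem lift_u (x y : B) (h : x * y - y * x - y ^ 2 = 0) : lift (k := k) x y h (u k) = x :=
  (RingQuot.liftAlgHom_mkAlgHom_apply k _ _ _).trans (by simp)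

@[simp]
theorem lift_v (x y : B) (h : x * y - y * x - y ^ 2 = 0) : lift (k := k) x y h (v k) = y :=
  (RingQuot.liftAlgHom_mkAlgHom_apply k _ _ _).trans (by simp)

variable (k) in
theorem adjoin_eq_top : Algebra.adjoin k {u k, v k} = ⊤ := by
  have h : (mk k).range = ⊤ := (AlgHom.range_eq_top _).mpr (RingQuot.mkAlgHom_surjective k _)
  rw [← h, ← Algebra.map_top, ← FreeAlgebra.adjoin_range_ι, AlgHom.map_adjoin, ← Set.range_comp]
  congr 1
  ext x
  simp [u, v, eq_comm]

end JordanPlane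

namespace SAlg

variable {k : Type*} [Field k] {B : Type*} [Ring B] [Algebra k B]

/-- The algebra map from `S` given by three elements that satisfy the defining relations. -/
noncomputable def lift (x y z : B) (h₁ : x * y - y * x - y ^ 2 = 0) (h₂ : x * z - z * x - y * z = 0)
    (h₃ : y * z - z * y = 0) : SAlg k →ₐ[k] B :=
  RingQuot.liftAlgHom k ⟨FreeAlgebra.lift k ![x, y, z], by
    rintro _ _ ⟨⟩
    · simpa using h₁
    · simpa using h₂
    · simpa using h₃⟩

variable (x y z : B) (h₁ : x * y - y * x - y ^ 2 = 0) (h₂ : x * z - z * x - y * z = 0)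
    (h₃ : y * z - z * y = 0)

@[simp]
theorem lift_u : lift (k := k) x y z h₁ h₂ h₃ (u k) = x :=
  (RingQuot.liftAlgHom_mkAlgHom_apply k _ _ _).trans (by simp)

@[simp]
theorem lift_v : lift (k := k) x y z h₁ h₂ h₃ (v k) = y :=
  (RingQuot.liftAlgHom_mkAlgHom_apply k _ _ _).trans (by simp)

@[simp]
theorem lift_w : lift (k := k) x y z h₁ h₂ h₃ (w k) = z :=
  (RingQuot.liftAlgHom_mkAlgHom_apply k _ _ _).trans (by simp)

end SAlg

/-! ### Leading terms -/

section Leading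

variable {k : Type*} [Field k] {M W : Type*} [LinearOrder W]

/-- The vector `x` is a nonzero multiple of the basis vector `μ` plus terms of smaller weight. -/
def HasLeading (wt : M → W) (μ : M) (x : M →₀ k) : Prop :=
  ∃ c : k, c ≠ 0 ∧ x - Finsupp.single μ c ∈ Finsupp.supported k k {ν | wt ν < wt μ}

theorem HasLeading.single (wt : M → W) (μ : M) {c : k} (hc : c ≠ 0) :
    HasLeading wt μ (Finsupp.single μ c) :=
  ⟨c, hc, by simp⟩

theorem linearIndependent_of_hasLeading {I : Type*} {wt : M → W} {σ : I → M}
    (hσ : Function.Injective σ) {f : I → M →₀ k} (h : ∀ i, HasLeading wt (σ i) (f i)) :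
    LinearIndependent k f := by
  classical
  choose c hc hf using h
  have hf₁ : ∀ i j, wt (σ i) ≤ wt (σ j) → j ≠ i → f i (σ j) = 0 := by
    intro i j hij hne
    have := (Finsupp.mem_supported' k _).mp (hf i) (σ j) (by simpa using hij)
    rwa [Finsupp.sub_apply, Finsupp.single_eq_of_ne (by simpa using hσ.ne hne), sub_zero] at this
  have hf₂ : ∀ i, f i (σ i) = c i := by
    intro i
    have := (Finsupp.mem_supported' k _).mp (hf i) (σ i) (by simp)
    rwa [Finsupp.sub_apply, Finsupp.single_eq_same, sub_eq_zero] at this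
  rw [linearIndependent_iff]
  intro l hl
  by_contra hne
  obtain ⟨i, hi, hmax⟩ := Finset.exists_max_image l.support (fun i => wt (σ i))
    (Finsupp.support_nonempty_iff.mpr hne)
  have h₀ := DFunLike.congr_fun hl (σ i)
  rw [Finsupp.linearCombination_apply, Finsupp.sum, Finsupp.finsetSum_apply,
    Finset.sum_eq_single i] at h₀
  · simp only [Finsupp.smul_apply, hf₂, smul_eq_mul, Finsupp.zero_apply, mul_eq_zero] at h₀
    exact h₀.elim (Finsupp.mem_support_iff.mp hi) (hc i)
  · intro j hj hji
    rw [Finsupp.smul_apply, hf₁ j i (hmax j hj) hji.symm, smul_zero]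
  · exact fun h => absurd hi h

theorem HasLeading.map {wt : M → W} {τ : M → M} {T : Module.End k (M →₀ k)}
    (hτ : ∀ μ ν, wt ν < wt μ → wt (τ ν) < wt (τ μ))
    (hT : ∀ μ, T (Finsupp.single μ 1) - Finsupp.single (τ μ) 1
      ∈ Finsupp.supported k k {ν | wt ν < wt (τ μ)})
    {μ : M} {x : M →₀ k} (hx : HasLeading wt μ x) : HasLeading wt (τ μ) (T x) := by
  have hlow : ∀ y ∈ Finsupp.supported k k {ν | wt ν < wt μ},
      T y ∈ Finsupp.supported k k {ν | wt ν < wt (τ μ)} := by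
    intro y hy
    rw [Finsupp.supported_eq_span_single] at hy
    induction hy using Submodule.span_induction with
    | zero => simp
    | add y z _ _ hy hz => rw [map_add]; exact add_mem hy hz
    | smul c y _ hy => rw [map_smul]; exact Submodule.smul_mem _ c hy
    | mem y hy =>
      obtain ⟨ν, hν, rfl⟩ := hy
      rw [← sub_add_cancel (T (Finsupp.single ν 1)) (Finsupp.single (τ ν) 1)]
      exact add_mem (Finsupp.supported_mono (fun ξ hξ => lt_trans hξ (hτ μ ν hν)) (hT ν))
        (Finsupp.single_mem_supported k 1 (hτ μ ν hν))
  obtain ⟨c, hc, h⟩ := hx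
  refine ⟨c, hc, ?_⟩
  have : T x - Finsupp.single (τ μ) c
      = T (x - Finsupp.single μ c) + c • (T (Finsupp.single μ 1) - Finsupp.single (τ μ) 1) := by
    rw [map_sub, smul_sub, ← map_smul]
    simp
  rw [this]
  exact add_mem (hlow _ h) (Submodule.smul_mem _ c (hT μ))

theorem HasLeading.pow {wt : M → W} {τ : M → M} {T : Module.End k (M →₀ k)}
    (hτ : ∀ μ ν, wt ν < wt μ → wt (τ ν) < wt (τ μ))
    (hT : ∀ μ, T (Finsupp.single μ 1) - Finsupp.single (τ μ) 1
      ∈ Finsupp.supported k k {ν | wt ν < wt (τ μ)})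
    {μ : M} {x : M →₀ k} (hx : HasLeading wt μ x) (n : ℕ) :
    HasLeading wt (τ^[n] μ) ((T ^ n) x) := by
  induction n with
  | zero => simpa using hx
  | succ n ih =>
    rw [Function.iterate_succ_apply', pow_succ', Module.End.mul_apply]
    exact ih.map hτ hT

end Leading

/-! ### Representations of `R` and `S` on polynomials -/

namespace JordanPlane

variable (k : Type*) [Field k]

/-- The action of `u` on `k[x, v]`. -/
noncomputable def repU : Module.End k (ℕ × ℕ →₀ k) :=
  Finsupp.linearCombination k fun p => Finsupp.single (p.1 + 1, p.2) 1
    + Finsupp.single (p.1, p.2 + 1) (p.2 : k)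

/-- The action of `v` on `k[x, v]`. -/
noncomputable def repV : Module.End k (ℕ × ℕ →₀ k) :=
  Finsupp.linearCombination k fun p => Finsupp.single (p.1, p.2 + 1) 1

theorem repU_single (p : ℕ × ℕ) (c : k) : repU k (Finsupp.single p c)
    = Finsupp.single (p.1 + 1, p.2) c + Finsupp.single (p.1, p.2 + 1) (c * p.2) := by
  simp [repU]

theorem repV_single (p : ℕ × ℕ) (c : k) :
    repV k (Finsupp.single p c) = Finsupp.single (p.1, p.2 + 1) c := by
  simp [repV]

/-- The representation of `R` on `k[x, v]` in which `u` acts as `x + v² ∂/∂v`. -/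
noncomputable def rep : JordanPlane k →ₐ[k] Module.End k (ℕ × ℕ →₀ k) :=
  lift (repU k) (repV k) (by
    refine Finsupp.lhom_ext fun p c => ?_
    simp only [LinearMap.sub_apply, Module.End.mul_apply, repU_single, repV_single, sq, map_add,
      LinearMap.zero_apply]
    push_cast
    rw [mul_add, Finsupp.single_add, mul_one]
    abel)

theorem rep_v_pow (n : ℕ) (p : ℕ × ℕ) (c : k) :
    rep k (v k ^ n) (Finsupp.single p c) = Finsupp.single (p.1, p.2 + n) c := by
  rw [map_pow, rep, lift_v]
  induction n with
  | zero => simp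
  | succ n ih => rw [pow_succ', Module.End.mul_apply, ih, repV_single, add_assoc]

theorem hasLeading_rep_u_pow {μ : ℕ × ℕ} {x : ℕ × ℕ →₀ k} (hx : HasLeading Prod.fst μ x) (i : ℕ) :
    HasLeading Prod.fst (μ.1 + i, μ.2) (rep k (u k ^ i) x) := by
  have h := hx.pow (T := repU k) (τ := fun p => (p.1 + 1, p.2)) (fun μ ν h => by simpa using h)
    (fun μ => by
      rw [repU_single, add_sub_cancel_left]
      exact Finsupp.single_mem_supported k _ (Nat.lt_succ_self _)) i
  rw [map_pow, rep, lift_u]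
  have : ∀ i, (fun p : ℕ × ℕ => (p.1 + 1, p.2))^[i] μ = (μ.1 + i, μ.2) := by
    intro i
    induction i with
    | zero => rfl
    | succ i ih => rw [Function.iterate_succ_apply', ih]; rfl
  rwa [this] at h

theorem hasLeading_rep_gen (a : k) (n : ℕ) :
    HasLeading Prod.fst (1, n)
      (rep k ((u k - ((n : k) * a) • v k) * v k ^ n) (Finsupp.single (0, 0) 1)) := by
  refine ⟨1, one_ne_zero, ?_⟩
  rw [map_mul, Module.End.mul_apply, rep_v_pow, map_sub, map_smul, LinearMap.sub_apply,
    LinearMap.smul_apply, rep, lift_u, lift_v, repU_single, repV_single]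
  simp only [zero_add, one_mul, Finsupp.smul_single]
  rw [add_sub_assoc, add_sub_cancel_left]
  exact sub_mem (Finsupp.single_mem_supported k _ (by simp))
    (Finsupp.single_mem_supported k _ (by simp))

end JordanPlane

namespace SAlg

variable (k : Type*) [Field k]

/-- The action of `u` on `k[x, y, v]`. -/
noncomputable def repU : Module.End k (ℕ × ℕ × ℕ →₀ k) :=
  Finsupp.linearCombination k fun p => Finsupp.single (p.1 + 1, p.2.1, p.2.2) 1
    + Finsupp.single (p.1, p.2.1, p.2.2 + 1) ((p.1 : k) + p.2.1 + p.2.2)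

/-- The action of `v` on `k[x, y, v]`. -/
noncomputable def repV : Module.End k (ℕ × ℕ × ℕ →₀ k) :=
  Finsupp.linearCombination k fun p => Finsupp.single (p.1, p.2.1, p.2.2 + 1) 1

/-- The action of `w` on `k[x, y, v]`. -/
noncomputable def repW : Module.End k (ℕ × ℕ × ℕ →₀ k) :=
  Finsupp.linearCombination k fun p => Finsupp.single (p.1 + 1, p.2.1, p.2.2) 1
    - Finsupp.single (p.1, p.2.1 + 1, p.2.2) 1

theorem repU_single (a b d : ℕ) (c : k) : repU k (Finsupp.single (a, b, d) c)
    = Finsupp.single (a + 1, b, d) c + Finsupp.single (a, b, d + 1) (c * ((a : k) + b + d)) := by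
  simp [repU, -Finsupp.single_add, -Finsupp.single_mul]

theorem repV_single (a b d : ℕ) (c : k) :
    repV k (Finsupp.single (a, b, d) c) = Finsupp.single (a, b, d + 1) c := by
  simp [repV]

theorem repW_single (a b d : ℕ) (c : k) : repW k (Finsupp.single (a, b, d) c)
    = Finsupp.single (a + 1, b, d) c - Finsupp.single (a, b + 1, d) c := by
  simp [repW, smul_sub]

/-- The representation of `S` on `k[x, y, v]` in which `w` acts as `x - y` and `u` acts as
`x + v D`, where `D` is the Euler operator. -/
noncomputable def rep : SAlg k →ₐ[k] Module.End k (ℕ × ℕ × ℕ →₀ k) :=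
  lift (repU k) (repV k) (repW k)
    (by
      refine Finsupp.lhom_ext fun ⟨a, b, d⟩ c => ?_
      simp only [LinearMap.sub_apply, Module.End.mul_apply, repU_single, repV_single, sq, map_add,
        LinearMap.zero_apply]
      push_cast
      simp only [mul_add, Finsupp.single_add, mul_one]
      abel)
    (by
      refine Finsupp.lhom_ext fun ⟨a, b, d⟩ c => ?_
      simp only [LinearMap.sub_apply, Module.End.mul_apply, repU_single, repV_single, repW_single,
        map_add, map_sub, LinearMap.zero_apply]
      push_cast
      simp only [mul_add, Finsupp.single_add, mul_one]
      abel)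
    (by
      refine Finsupp.lhom_ext fun ⟨a, b, d⟩ c => ?_
      simp only [LinearMap.sub_apply, Module.End.mul_apply, repV_single, repW_single, map_sub,
        LinearMap.zero_apply]
      abel)

theorem rep_v_pow (n a b d : ℕ) (c : k) :
    rep k (v k ^ n) (Finsupp.single (a, b, d) c) = Finsupp.single (a, b, d + n) c := by
  rw [map_pow, rep, lift_v]
  induction n with
  | zero => simp
  | succ n ih => rw [pow_succ', Module.End.mul_apply, ih, repV_single, add_assoc]

/-- The weight on monomials of `k[x, y, v]`: the degree in `x` and `y`, then the degree in `x`. -/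
def wt (p : ℕ × ℕ × ℕ) : ℕ ×ₗ ℕ := toLex (p.1 + p.2.1, p.1)

theorem wt_lt {p q : ℕ × ℕ × ℕ} :
    wt p < wt q ↔ p.1 + p.2.1 < q.1 + q.2.1 ∨ p.1 + p.2.1 = q.1 + q.2.1 ∧ p.1 < q.1 :=
  Prod.Lex.toLex_lt_toLex

theorem hasLeading_rep_u_pow {a b d : ℕ} {x : ℕ × ℕ × ℕ →₀ k} (hx : HasLeading wt (a, b, d) x)
    (i : ℕ) : HasLeading wt (a + i, b, d) (rep k (u k ^ i) x) := by
  have h := hx.pow (T := repU k) (τ := fun p => (p.1 + 1, p.2.1, p.2.2))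
    (fun μ ν h => by rw [wt_lt] at h ⊢; dsimp only; omega)
    (fun μ => by
      rw [repU_single, add_sub_cancel_left]
      exact Finsupp.single_mem_supported k _ (wt_lt.mpr
        (Or.inl (Nat.lt_of_lt_of_eq (Nat.lt_add_one _) (by ring))))) i
  rw [map_pow, rep, lift_u]
  have : ∀ i, (fun p : ℕ × ℕ × ℕ => (p.1 + 1, p.2.1, p.2.2))^[i] (a, b, d) = (a + i, b, d) := by
    intro i
    induction i with
    | zero => rfl
    | succ i ih => rw [Function.iterate_succ_apply', ih]; rfl
  rwa [this] at h

theorem hasLeading_rep_pow {a b d : ℕ} {x : ℕ × ℕ × ℕ →₀ k} (hx : HasLeading wt (a, b, d) x)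
    (j : ℕ) : HasLeading wt (a, b + j, d + j) (rep k (((u k - w k) * v k) ^ j) x) := by
  have h := hx.pow (T := (repU k - repW k) * repV k)
    (τ := fun p => (p.1, p.2.1 + 1, p.2.2 + 1))
    (fun μ ν h => by rw [wt_lt] at h ⊢; dsimp only; omega)
    (fun μ => by
      rw [Module.End.mul_apply, repV_single, LinearMap.sub_apply, repU_single, repW_single]
      simp only [add_sub_cancel_left, one_mul, add_sub_right_comm, sub_sub_cancel]
      exact Finsupp.single_mem_supported k _ (wt_lt.mpr
        (Or.inl (Nat.lt_of_lt_of_eq (Nat.lt_add_one _) (by ring))))) j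
  rw [map_pow, map_mul, map_sub, rep, lift_u, lift_v, lift_w]
  have : ∀ j, (fun p : ℕ × ℕ × ℕ => (p.1, p.2.1 + 1, p.2.2 + 1))^[j] (a, b, d)
      = (a, b + j, d + j) := by
    intro i
    induction i with
    | zero => rfl
    | succ i ih => rw [Function.iterate_succ_apply', ih]; rfl
  rwa [this] at h

theorem hasLeading_rep_gen [CharZero k] (n : ℕ) :
    HasLeading wt (1, 0, n + 2)
      (rep k ((u k - ((n + 2 : ℕ) : k) • w k) * v k ^ (n + 2)) (Finsupp.single (0, 0, 0) 1)) := by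
  refine ⟨1 - ((n + 2 : ℕ) : k), ?_, ?_⟩
  · rw [sub_ne_zero]; exact_mod_cast (by omega : 1 ≠ n + 2)
  rw [map_mul, Module.End.mul_apply, rep_v_pow, map_sub, map_smul, LinearMap.sub_apply,
    LinearMap.smul_apply, rep, lift_u, lift_w, repU_single, repW_single]
  simp only [zero_add, one_mul, smul_sub, Finsupp.smul_single, smul_eq_mul, mul_one,
    Finsupp.single_sub]
  rw [show ∀ p q r s : ℕ × ℕ × ℕ →₀ k, p + q - (r - s) - (p - r) = q + s from
    fun p q r s => by abel]
  exact add_mem (Finsupp.single_mem_supported k _ (wt_lt.mpr (by simp)))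
    (Finsupp.single_mem_supported k _ (wt_lt.mpr (by simp)))

end SAlg

/-! ### The kernels -/

universe u

namespace UWittPos

variable (k : Type*) [Field k]

/-- The generators of `U(W₊)`, indexed from `0`: `gen i = e (i + 1)`. -/
noncomputable def gen (i : ℕ) : UWittPos k := e k i.succPNat

section

attribute [local instance 100] LieRing.ofAssociativeRing

theorem isWittFamily_gen : IsWittFamily k (gen k) := by
  intro i j
  have h : ⁅WittPos.e k i.succPNat, WittPos.e k j.succPNat⁆
      = ((j : k) - i) • WittPos.e k (i + j + 1).succPNat := by
    refine Subtype.ext ?_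
    refine (Witt.lie_e k _ _).trans ?_
    change _ = ((j : k) - i) • Witt.e k _
    congr 1
    · push_cast; simp
    · congr 1; push_cast [Nat.succPNat_coe]; ring
  have h' := congrArg (UniversalEnvelopingAlgebra.ι k) h
  rw [LieHom.map_lie, map_smul, LieRing.of_associative_ring_bracket] at h'
  exact h'

end

theorem adjoin_gen : Algebra.adjoin k (Set.range (gen k)) = ⊤ := by
  have h₁ : ∀ x : WittPos k,
      UniversalEnvelopingAlgebra.ι k x ∈ Algebra.adjoin k (Set.range (gen k)) := by
    rintro ⟨x, hx⟩
    have hx' : x ∈ Submodule.span k {x | ∃ n : ℤ, 1 ≤ n ∧ x = Witt.e k n} := by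
      rw [← WittPos.toSubmodule_eq]; exact hx
    induction hx' using Submodule.span_induction with
    | zero => exact (map_zero (UniversalEnvelopingAlgebra.ι k (L := WittPos k))).symm ▸ zero_mem _
    | add x y hx' hy' ihx ihy =>
      rw [← WittPos.toSubmodule_eq] at hx' hy'
      have := add_mem (ihx hx') (ihy hy')
      rwa [← map_add] at this
    | smul c x hx' ihx =>
      rw [← WittPos.toSubmodule_eq] at hx'
      have := Subalgebra.smul_mem _ (ihx hx') c
      rwa [← map_smul] at this
    | mem x hx' =>
      obtain ⟨n, hn, rfl⟩ := hx'
      obtain ⟨i, rfl⟩ : ∃ i : ℕ, n = i + 1 := ⟨(n - 1).toNat, by omega⟩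
      refine Algebra.subset_adjoin ⟨i, ?_⟩
      rw [gen, e, WittPos.e]
      rfl
  have h₂ : (UniversalEnvelopingAlgebra.mkAlgHom k (WittPos k)).range = ⊤ :=
    (AlgHom.range_eq_top _).mpr (RingCon.mkₐ_surjective _)
  rw [← top_le_iff, ← h₂, ← Algebra.map_top, ← TensorAlgebra.adjoin_range_ι, AlgHom.map_adjoin,
    Algebra.adjoin_le_iff]
  rintro _ ⟨_, ⟨x, rfl⟩, rfl⟩
  exact h₁ x

variable {k}

theorem map_mem_of_mul_mem {A : Type*} [Ring A] [Algebra k A] (f : UWittPos k →ₐ[k] A)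
    {N : Submodule k A} (h₁ : 1 ∈ N) (h : ∀ m, ∀ y ∈ N, f (gen k m) * y ∈ N) (x : UWittPos k) :
    f x ∈ N := by
  have key : ∀ x ∈ Algebra.adjoin k (Set.range (gen k)), ∀ y ∈ N, f x * y ∈ N := by
    intro x hx
    induction hx using Algebra.adjoin_induction with
    | mem x hx => obtain ⟨m, rfl⟩ := hx; exact h m
    | algebraMap c => intro y hy; rw [AlgHom.commutes, ← Algebra.smul_def]; exact N.smul_mem c hy
    | add x y _ _ hx hy =>
      intro z hz; rw [map_add, add_mul]; exact add_mem (hx z hz) (hy z hz)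
    | mul x y _ _ hx hy =>
      intro z hz; rw [map_mul, mul_assoc]; exact hx _ (hy z hz)
  simpa using key x (by rw [adjoin_gen]; trivial) 1 h₁

/-- A kernel is generated by a set `s` of its elements if a family of elements spans the quotient
by `s` and has linearly independent images. -/
theorem ker_eq_span {k : Type u} [Field k] {ι B V : Type*} [Ring B] [Algebra k B]
    [AddCommGroup V] [Module k V]
    (f : UWittPos k →ₐ[k] B) (s : Set (UWittPos k)) (hs : ∀ x ∈ s, f x = 0)
    (nf : ι → UWittPos k) (g : B →ₗ[k] V) (hg : LinearIndependent k fun i => g (f (nf i)))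
    (hspan : ∀ (A : Type u) [Ring A] [Algebra k A] (π : UWittPos k →ₐ[k] A), (∀ x ∈ s, π x = 0) →
      1 ∈ Submodule.span k (Set.range fun i => π (nf i)) ∧
      ∀ m, ∀ y ∈ Submodule.span k (Set.range fun i => π (nf i)),
        π (gen k m) * y ∈ Submodule.span k (Set.range fun i => π (nf i))) :
    TwoSidedIdeal.ker f = TwoSidedIdeal.span s := by
  apply le_antisymm
  · intro x hx
    rw [TwoSidedIdeal.mem_ker] at hx
    let π : UWittPos k →ₐ[k] (TwoSidedIdeal.span s).ringCon.Quotient :=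
      (TwoSidedIdeal.span s).ringCon.mkₐ k
    have hπ : ∀ x, π x = 0 ↔ x ∈ TwoSidedIdeal.span s := fun x =>
      RingCon.eq _
    obtain ⟨h₁, h₂⟩ := hspan _ π fun x hx => (hπ x).mpr (TwoSidedIdeal.subset_span hx)
    have hmem := map_mem_of_mul_mem π h₁ h₂ x
    obtain ⟨c, hc⟩ := (Finsupp.mem_span_range_iff_exists_finsupp).mp hmem
    have hy : π (x - c.sum fun i a => a • nf i) = 0 := by
      rw [map_sub, map_finsuppSum, sub_eq_zero, ← hc]
      simp only [map_smul]
    have hy' : f (x - c.sum fun i a => a • nf i) = 0 := by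
      have hle : TwoSidedIdeal.span s ≤ TwoSidedIdeal.ker f :=
        TwoSidedIdeal.span_le.mpr fun x hx => (TwoSidedIdeal.mem_ker f).mpr (hs x hx)
      exact (TwoSidedIdeal.mem_ker f).mp (hle ((hπ _).mp hy))
    have hc0 : c = 0 := by
      refine (linearIndependent_iff.mp hg) c ?_
      rw [map_sub, hx, zero_sub, neg_eq_zero] at hy'
      have := congrArg g hy'
      rw [map_zero, map_finsuppSum, map_finsuppSum] at this
      rw [Finsupp.linearCombination_apply, ← this]
      simp only [map_smul]
    rw [hc0, Finsupp.sum_zero_index, sub_zero] at hy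
    exact (hπ x).mp hy
  · exact TwoSidedIdeal.span_le.mpr fun x hx => (TwoSidedIdeal.mem_ker f).mpr (hs x hx)

theorem lam_gen (a : k) (i : ℕ) :
    lam a (gen k i)
      = (JordanPlane.u k - ((i : k) * a) • JordanPlane.v k) * JordanPlane.v k ^ i := by
  rw [gen, lam_e]; simp

variable (k) in
theorem phi_gen (i : ℕ) :
    phi k (gen k i) = (SAlg.u k - (i : k) • SAlg.w k) * SAlg.v k ^ i := by
  rw [gen, phi_e]; simp

/-- The maps `λ_a` factor through `φ`. -/
theorem lam_eq_zero_of_phi_eq_zero (a : k) {x : UWittPos k} (hx : phi k x = 0) : lam a x = 0 := by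
  let p : SAlg k →ₐ[k] JordanPlane k :=
    SAlg.lift (JordanPlane.u k) (JordanPlane.v k) (a • JordanPlane.v k) (JordanPlane.rel_uv k)
      (by
        rw [mul_smul_comm, smul_mul_assoc, mul_smul_comm, ← smul_sub, ← smul_sub, ← sq,
          JordanPlane.rel_uv, smul_zero])
      (by rw [mul_smul_comm, smul_mul_assoc, sub_self])
  have h : ∀ y ∈ Algebra.adjoin k (Set.range (gen k)), lam a y = p (phi k y) := by
    intro y hy
    induction hy using Algebra.adjoin_induction with
    | mem y hy =>
      obtain ⟨m, rfl⟩ := hy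
      rw [lam_gen, phi_gen, map_mul, map_sub, map_smul, map_pow, SAlg.lift_u, SAlg.lift_v,
        SAlg.lift_w, smul_smul]
    | algebraMap c => simp
    | add x y _ _ hx hy => simp only [map_add, hx, hy]
    | mul x y _ _ hx hy => simp only [map_mul, hx, hy]
  rw [h x (by rw [adjoin_gen]; trivial), hx, map_zero]

end UWittPos

section Products

variable {k : Type*} [Field k] {A : Type*} [Ring A] [Algebra k A]

theorem WittPos.mul_eq {u v w : A} (h₁ : u * v - v * u - v ^ 2 = 0)
    (h₂ : u * w - w * u - v * w = 0) (h₃ : v * w - w * v = 0) (i j : ℕ) :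
    (u - (i : k) • w) * v ^ i * ((u - (j : k) • w) * v ^ j)
      = u * u * v ^ (i + j) - (i : k) • (u * v ^ (i + j + 1))
        - ((i : k) + j) • (u * w * v ^ (i + j))
        + ((i : k) * (i + 1)) • (w * v ^ (i + j + 1)) + ((i : k) * j) • (w * w * v ^ (i + j)) := by
  have hvw : Commute v w := sub_eq_zero.mp h₃
  have hwu : w * u = u * w - w * v := by
    rw [← hvw.eq, ← sub_eq_zero, ← neg_eq_zero, ← h₂]; abel
  have e₁ : v ^ i * ((u - (j : k) • w) * v ^ j)
      = u * v ^ (i + j) - (i : k) • v ^ (i + j + 1) - (j : k) • (w * v ^ (i + j)) := by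
    rw [← mul_assoc, mul_sub, WittPos.pow_mul_comm_aux (k := k) h₁, mul_smul_comm,
      (hvw.pow_left i).eq, sub_mul, sub_mul, smul_mul_assoc, smul_mul_assoc, mul_assoc,
      mul_assoc, ← pow_add, ← pow_add, show i + 1 + j = i + j + 1 by ring]
  have e₂ : w * (u * v ^ (i + j)) = u * w * v ^ (i + j) - w * v ^ (i + j + 1) := by
    rw [← mul_assoc, hwu, sub_mul, mul_assoc w v, ← pow_succ']
  rw [mul_assoc, e₁, sub_mul]
  simp only [mul_sub, smul_mul_assoc, mul_smul_comm, e₂, smul_sub, smul_smul]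
  simp only [← mul_assoc]
  module

end Products

namespace UWittPos

variable (k : Type*) [Field k]

theorem phi_degSix : phi k (gen k 0 * gen k 4 - 4 * (gen k 1 * gen k 3) + 3 * gen k 2 ^ 2
    + 2 * gen k 5) = 0 := by
  have h := WittPos.mul_eq (k := k) (SAlg.rel_uv k) (SAlg.rel_uw k) (SAlg.rel_vw k)
  have four : ∀ x : SAlg k, 4 * x = (4 : k) • x := fun x => by rw [Algebra.smul_def, map_ofNat]
  have three : ∀ x : SAlg k, 3 * x = (3 : k) • x := fun x => by rw [Algebra.smul_def, map_ofNat]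
  have two : ∀ x : SAlg k, 2 * x = (2 : k) • x := fun x => by rw [Algebra.smul_def, map_ofNat]
  rw [sq]
  simp only [map_add, map_sub, map_mul, map_ofNat, phi_gen, h, four, three, two]
  norm_num [sub_mul]
  module

variable {k}

theorem lam_mul_gen (a : k) (i j : ℕ) :
    lam a (gen k i * gen k j) = JordanPlane.u k * JordanPlane.u k * JordanPlane.v k ^ (i + j)
      - ((i : k) + (i + j) * a) • (JordanPlane.u k * JordanPlane.v k ^ (i + j + 1))
      + ((i : k) * (i + 1) * a + i * j * a ^ 2) • JordanPlane.v k ^ (i + j + 2) := by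
  have h := WittPos.mul_eq (k := k) (w := a • JordanPlane.v k) (JordanPlane.rel_uv k)
    (by
        rw [mul_smul_comm, smul_mul_assoc, mul_smul_comm, ← smul_sub, ← smul_sub, ← sq,
          JordanPlane.rel_uv, smul_zero])
    (by rw [mul_smul_comm, smul_mul_assoc, sub_self]) i j
  rw [map_mul, lam_gen, lam_gen, ← smul_smul, ← smul_smul, h]
  have e₁ : JordanPlane.u k * JordanPlane.v k * JordanPlane.v k ^ (i + j)
      = JordanPlane.u k * JordanPlane.v k ^ (i + j + 1) := by rw [mul_assoc, ← pow_succ']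
  have e₂ : JordanPlane.v k * JordanPlane.v k ^ (i + j + 1) = JordanPlane.v k ^ (i + j + 2) := by
    rw [← pow_succ']
  have e₃ : JordanPlane.v k * JordanPlane.v k * JordanPlane.v k ^ (i + j)
      = JordanPlane.v k ^ (i + j + 2) := by rw [← sq, ← pow_add, add_comm]
  simp only [smul_mul_assoc, mul_smul_comm, e₁, e₂, e₃]
  module

theorem lam_degSix (a : k) : lam a (gen k 0 * gen k 4 - 4 * (gen k 1 * gen k 3)
    + 3 * gen k 2 ^ 2 + 2 * gen k 5) = 0 :=
  lam_eq_zero_of_phi_eq_zero a (phi_degSix k)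

theorem hasLeading_lam_nfDegFour (a : k) (i : ℕ ⊕ ℕ × ℕ) :
    HasLeading Prod.fst (Sum.elim (fun i => (i, 0)) (fun p : ℕ × ℕ => (p.1 + 1, p.2 + 1)) i)
      (JordanPlane.rep k (lam a (nfDegFour (gen k) i)) (Finsupp.single (0, 0) 1)) := by
  have h₀ : lam a (gen k 0) = JordanPlane.u k := by rw [lam_gen]; simp
  rcases i with i | ⟨i, n⟩
  · change HasLeading Prod.fst (i, 0) (JordanPlane.rep k (lam a (gen k 0 ^ i)) _)
    rw [map_pow, h₀]
    simpa using JordanPlane.hasLeading_rep_u_pow k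
      (HasLeading.single Prod.fst ((0, 0) : ℕ × ℕ) (one_ne_zero (α := k))) i
  · change HasLeading Prod.fst (i + 1, n + 1)
      (JordanPlane.rep k (lam a (gen k 0 ^ i * gen k (n + 1))) _)
    rw [map_mul, map_pow, h₀, lam_gen, map_mul, Module.End.mul_apply]
    have := JordanPlane.hasLeading_rep_u_pow k (JordanPlane.hasLeading_rep_gen k a (n + 1)) i
    rwa [add_comm 1 i] at this

variable [CharZero k]

theorem lam_quadZ (a : k) (t : ℕ) :
    lam a (quadZ k (gen k) t) = (a ^ 2 - a) • JordanPlane.v k ^ (t + 4) := by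
  rw [← sub_eq_zero, ← smul_eq_zero_iff_right (Nat.cast_add_one_ne_zero (R := k) t), smul_sub,
    ← map_smul, (isWittFamily_gen k).smul_quadZ_eq, map_add, map_sub, lam_mul_gen, lam_mul_gen,
    lam_gen]
  rw [show 1 + (t + 1) = t + 2 by ring, show 0 + (t + 2) = t + 2 by ring, sub_mul, smul_mul_assoc,
    ← pow_succ']
  push_cast
  module

theorem lam_cubicRel (a : k) (n t : ℕ) : lam a (cubicRel (gen k) a n t) = 0 := by
  rw [cubicRel, map_sub, map_sub, map_mul, map_smul, map_smul, lam_quadZ, lam_quadZ, lam_gen,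
    lam_gen, mul_smul_comm, mul_assoc, ← pow_add, show n + (t + 4) = n + t + 4 by ring, sub_mul,
    sub_mul, smul_mul_assoc, smul_mul_assoc, ← pow_succ']
  push_cast
  rw [show n + t + 1 + 4 = n + t + 4 + 1 by ring]
  module

theorem degFour_eq_neg_quadZ :
    gen k 0 * gen k 2 - gen k 1 ^ 2 - gen k 3 = -quadZ k (gen k) 0 := by
  have := (isWittFamily_gen k).smul_quadZ_eq 0
  simp only [Nat.cast_zero, zero_add, one_smul] at this
  rw [this, sq]; abel

theorem ker_lam_special {a : k} (ha : a = 0 ∨ a = 1) : TwoSidedIdeal.ker (lam a) =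
    TwoSidedIdeal.span {gen k 0 * gen k 2 - gen k 1 ^ 2 - gen k 3} := by
  refine ker_eq_span (lam a) _ ?_ (nfDegFour (gen k))
    (((LinearMap.applyₗ (Finsupp.single (0, 0) 1))).comp (JordanPlane.rep k).toLinearMap)
    (linearIndependent_of_hasLeading (σ := Sum.elim (fun i => (i, 0))
      (fun p : ℕ × ℕ => (p.1 + 1, p.2 + 1))) ?_ (hasLeading_lam_nfDegFour a)) ?_
  · rintro _ rfl
    rw [degFour_eq_neg_quadZ, map_neg, lam_quadZ]
    rcases ha with rfl | rfl <;> simp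
  · rintro (i | ⟨i, n⟩) (j | ⟨j, m⟩) h <;> simp_all
  · intro A _ _ π hπ
    have hnf : (fun i => π (nfDegFour (gen k) i)) = nfDegFour fun i => π (gen k i) := by
      funext i
      rcases i with i | ⟨i, n⟩ <;> simp [nfDegFour]
    rw [hnf]
    refine ⟨Submodule.subset_span ⟨Sum.inl 0, by simp [nfDegFour]⟩, fun m =>
      ((isWittFamily_gen k).comp π).nfDegFour_mul_mem ?_ m⟩
    simpa using hπ _ rfl

theorem ker_lam_generic {a : k} (h0 : a ≠ 0) (h1 : a ≠ 1) : TwoSidedIdeal.ker (lam a) =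
    TwoSidedIdeal.span {h₁ a, h₂ k, h₃ a} := by
  have e₁ : h₁ a = cubicRel (gen k) a 0 0 := ((isWittFamily_gen k).cubicRel_zero_zero a).symm
  have e₂ : h₂ k = gen k 0 * gen k 4 - 4 * (gen k 1 * gen k 3) + 3 * gen k 2 ^ 2 + 2 * gen k 5 :=
    rfl
  have e₃ : h₃ a = _ := (isWittFamily_gen k).degSix_eq_cubicRel a
  have hβ : a ^ 2 - a ≠ 0 := by
    rw [sq, ← mul_sub_one]; exact mul_ne_zero h0 (sub_ne_zero.mpr h1)
  refine ker_eq_span (lam a) _ ?_ (nfCubic k (gen k))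
    (((LinearMap.applyₗ (Finsupp.single (0, 0) 1))).comp (JordanPlane.rep k).toLinearMap)
    (linearIndependent_of_hasLeading (wt := Prod.fst) (σ := Sum.elim (Sum.elim (fun i => (i, 0))
      (fun p : ℕ × ℕ => (p.1 + 1, p.2 + 1))) fun t => (0, t + 4)) ?_ ?_) ?_
  · rintro _ (rfl | rfl | rfl)
    · rw [e₁, lam_cubicRel]
    · exact lam_degSix a
    · rw [e₃, map_add, map_sub, map_sub, map_neg, map_smul, map_smul, map_smul, map_smul, map_mul,
        lam_cubicRel, lam_cubicRel, lam_cubicRel, lam_degSix]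
      simp
  · rintro ((i | ⟨i, n⟩) | t) ((j | ⟨j, m⟩) | s) h <;> simp_all
  · rintro (i | t)
    · exact hasLeading_lam_nfDegFour a i
    · change HasLeading Prod.fst (0, t + 4)
        (JordanPlane.rep k (lam a (quadZ k (gen k) t)) (Finsupp.single (0, 0) 1))
      rw [lam_quadZ, map_smul, LinearMap.smul_apply, JordanPlane.rep_v_pow, Finsupp.smul_single,
        smul_eq_mul, mul_one, zero_add]
      exact HasLeading.single _ _ hβ
  · intro A _ _ π hπ
    have hnf : (fun i => π (nfCubic k (gen k) i)) = nfCubic k fun i => π (gen k i) := by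
      funext i
      rcases i with (i | ⟨i, n⟩) | t <;> simp [nfCubic, nfDegFour, map_quadZ]
    have q₂ := hπ (h₂ k) (by simp)
    have q₁ := hπ (h₁ a) (by simp)
    have q₃ := hπ (h₃ a) (by simp)
    rw [e₁, map_cubicRel] at q₁
    have c₁ := ((isWittFamily_gen k).comp π).comm_cubicRel
      (by simpa [e₂, map_ofNat] using q₂) a 0 0 0
    rw [q₁] at c₁
    have c₂ : cubicRel (fun i => π (gen k i)) a 0 1 = 0 := by simpa using c₁.symm
    rw [e₃] at q₃
    simp only [map_add, map_sub, map_neg, map_smul, map_mul π (gen k 0) (cubicRel _ _ _ _),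
      map_cubicRel, q₁, c₂] at q₃
    rw [← map_sub, ← map_add, ← map_add, ← e₂, q₂] at q₃
    rw [hnf]
    refine ⟨Submodule.subset_span ⟨Sum.inl (Sum.inl 0), by simp [nfCubic, nfDegFour]⟩, fun m =>
      ((isWittFamily_gen k).comp π).nfCubic_mul_mem (by simpa [e₂, map_ofNat] using q₂) q₁
        (by simpa using q₃) m⟩

variable (k) in
theorem ker_phi : TwoSidedIdeal.ker (phi k) = TwoSidedIdeal.span
    {gen k 0 * gen k 4 - 4 * (gen k 1 * gen k 3) + 3 * gen k 2 ^ 2 + 2 * gen k 5} := by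
  have g₀ : phi k (gen k 0) = SAlg.u k := by rw [phi_gen]; simp
  have g₁ : phi k (gen k 1) = (SAlg.u k - SAlg.w k) * SAlg.v k := by rw [phi_gen]; simp
  refine ker_eq_span (phi k) _ ?_ (nfDegSix (gen k))
    (((LinearMap.applyₗ (Finsupp.single (0, 0, 0) 1))).comp (SAlg.rep k).toLinearMap)
    (linearIndependent_of_hasLeading (wt := SAlg.wt)
      (σ := Sum.elim (fun p : ℕ × ℕ => (p.1, p.2, p.2))
        (fun p : ℕ × ℕ × ℕ => (1 + p.1, p.2.1, p.2.2 + 2 + p.2.1))) ?_ ?_) ?_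
  · rintro _ rfl
    exact phi_degSix k
  · rintro (⟨a, b⟩ | ⟨a, b, c⟩) (⟨i, j⟩ | ⟨i, j, n⟩) h <;> simp at h ⊢ <;> omega
  · rintro (⟨i, j⟩ | ⟨i, j, n⟩)
    · change HasLeading SAlg.wt (i, j, j)
        (SAlg.rep k (phi k (gen k 0 ^ i * gen k 1 ^ j)) (Finsupp.single (0, 0, 0) 1))
      rw [map_mul, map_pow, map_pow, g₀, g₁, map_mul, Module.End.mul_apply]
      simpa using SAlg.hasLeading_rep_u_pow k (SAlg.hasLeading_rep_pow k
        (HasLeading.single SAlg.wt ((0, 0, 0) : ℕ × ℕ × ℕ) (one_ne_zero (α := k))) j) i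
    · change HasLeading SAlg.wt (1 + i, j, n + 2 + j)
        (SAlg.rep k (phi k (gen k 0 ^ i * gen k 1 ^ j * gen k (n + 2)))
          (Finsupp.single (0, 0, 0) 1))
      rw [map_mul (phi k), map_mul (phi k), map_pow, map_pow, g₀, g₁, phi_gen, map_mul, map_mul,
        Module.End.mul_apply, Module.End.mul_apply]
      simpa only [zero_add] using SAlg.hasLeading_rep_u_pow k (SAlg.hasLeading_rep_pow k
        (SAlg.hasLeading_rep_gen k n) j) i
  · intro A _ _ π hπ
    have hnf : (fun i => π (nfDegSix (gen k) i)) = nfDegSix fun i => π (gen k i) := by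
      funext i
      rcases i with ⟨i, j⟩ | ⟨i, j, n⟩ <;> simp [nfDegSix]
    rw [hnf]
    refine ⟨Submodule.subset_span ⟨Sum.inl (0, 0), by simp [nfDegSix]⟩, fun m =>
      ((isWittFamily_gen k).comp π).nfDegSix_mul_mem ?_ m⟩
    simpa [map_ofNat] using hπ _ rfl

end UWittPos

/-! ### The Jordan plane is noetherian -/

namespace JordanPlane

variable (k : Type*) [Field k]

theorem v_pow_mul_u (j : ℕ) : v k ^ j * u k = u k * v k ^ j - (j : k) • v k ^ (j + 1) :=
  WittPos.pow_mul_comm_aux (rel_uv k) j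

theorem u_mul_v_pow (j : ℕ) : u k * v k ^ j = v k ^ j * u k + (j : k) • v k ^ (j + 1) := by
  rw [v_pow_mul_u, sub_add_cancel]

variable {k} in
theorem mul_mem_of_gen {N : Submodule k (JordanPlane k)} (hu : ∀ x ∈ N, u k * x ∈ N)
    (hv : ∀ x ∈ N, v k * x ∈ N) (r : JordanPlane k) : ∀ x ∈ N, r * x ∈ N := by
  have hr : r ∈ Algebra.adjoin k {u k, v k} := by rw [adjoin_eq_top]; trivial
  induction hr using Algebra.adjoin_induction with
  | mem r hr => obtain rfl | rfl := hr; exacts [hu, hv]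
  | algebraMap c => intro x hx; rw [← Algebra.smul_def]; exact N.smul_mem c hx
  | add r s _ _ hr hs => intro x hx; rw [add_mul]; exact add_mem (hr x hx) (hs x hx)
  | mul r s _ _ hr hs => intro x hx; rw [mul_assoc]; exact hr _ (hs x hx)

variable {k} in
theorem mul_mem_of_gen_right {N : Submodule k (JordanPlane k)} (hu : ∀ x ∈ N, x * u k ∈ N)
    (hv : ∀ x ∈ N, x * v k ∈ N) (r : JordanPlane k) : ∀ x ∈ N, x * r ∈ N := by
  have hr : r ∈ Algebra.adjoin k {u k, v k} := by rw [adjoin_eq_top]; trivial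
  induction hr using Algebra.adjoin_induction with
  | mem r hr => obtain rfl | rfl := hr; exacts [hu, hv]
  | algebraMap c => intro x hx; rw [← Algebra.commutes, ← Algebra.smul_def]; exact N.smul_mem c hx
  | add r s _ _ hr hs => intro x hx; rw [mul_add]; exact add_mem (hr x hx) (hs x hx)
  | mul r s _ _ hr hs => intro x hx; rw [← mul_assoc]; exact hs _ (hr x hx)

/-- The monomial `vʲ uⁱ`. -/
noncomputable def mon (p : ℕ × ℕ) : JordanPlane k := v k ^ p.2 * u k ^ p.1

theorem u_mul_mon (p : ℕ × ℕ) :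
    u k * mon k p = mon k (p.1 + 1, p.2) + (p.2 : k) • mon k (p.1, p.2 + 1) := by
  rw [mon, ← mul_assoc, u_mul_v_pow, add_mul, smul_mul_assoc, mul_assoc, ← pow_succ']
  rfl

theorem v_mul_mon (p : ℕ × ℕ) : v k * mon k p = mon k (p.1, p.2 + 1) := by
  rw [mon, ← mul_assoc, ← pow_succ']
  rfl

theorem span_mon : Submodule.span k (Set.range (mon k)) = ⊤ := by
  have h1 : (1 : JordanPlane k) ∈ Submodule.span k (Set.range (mon k)) :=
    Submodule.subset_span ⟨(0, 0), by simp [mon]⟩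
  have hm : ∀ p, mon k p ∈ Submodule.span k (Set.range (mon k)) :=
    fun p => Submodule.subset_span ⟨p, rfl⟩
  refine eq_top_iff.mpr fun r _ => ?_
  have := mul_mem_of_gen (IsWittFamily.span_mul_mem fun p => ?_)
    (IsWittFamily.span_mul_mem fun p => ?_) r 1 h1
  · rwa [mul_one] at this
  · rw [u_mul_mon]; exact add_mem (hm _) (Submodule.smul_mem _ _ (hm _))
  · rw [v_mul_mon]; exact hm _

/-- The span of the monomials below `μ` in the lexicographic order. -/
noncomputable def low (μ : ℕ × ℕ) : Submodule k (JordanPlane k) :=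
  Submodule.span k (mon k '' {ν | toLex ν < toLex μ})

theorem mon_mem_low {μ ν : ℕ × ℕ} (h : toLex ν < toLex μ) : mon k ν ∈ low k μ :=
  Submodule.subset_span ⟨ν, h, rfl⟩

variable {k}

theorem u_mul_low {μ : ℕ × ℕ} {x : JordanPlane k} (hx : x ∈ low k μ) :
    u k * x ∈ low k (μ.1 + 1, μ.2) := by
  induction hx using Submodule.span_induction with
  | zero => simp
  | add x y _ _ hx hy => rw [mul_add]; exact add_mem hx hy
  | smul c x _ hx => rw [mul_smul_comm]; exact Submodule.smul_mem _ c hx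
  | mem x hx =>
    obtain ⟨ν, hν, rfl⟩ := hx
    rw [Set.mem_ofPred_eq, Prod.Lex.toLex_lt_toLex] at hν
    rw [u_mul_mon]
    refine add_mem (mon_mem_low k ?_) (Submodule.smul_mem _ _ (mon_mem_low k ?_)) <;>
    · rw [Prod.Lex.toLex_lt_toLex]; dsimp only; omega

theorem v_mul_low {μ : ℕ × ℕ} {x : JordanPlane k} (hx : x ∈ low k μ) :
    v k * x ∈ low k (μ.1, μ.2 + 1) := by
  induction hx using Submodule.span_induction with
  | zero => simp
  | add x y _ _ hx hy => rw [mul_add]; exact add_mem hx hy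
  | smul c x _ hx => rw [mul_smul_comm]; exact Submodule.smul_mem _ c hx
  | mem x hx =>
    obtain ⟨ν, hν, rfl⟩ := hx
    rw [Set.mem_ofPred_eq, Prod.Lex.toLex_lt_toLex] at hν
    rw [v_mul_mon]
    refine mon_mem_low k ?_
    rw [Prod.Lex.toLex_lt_toLex]; dsimp only; omega

theorem exists_sub_mon_mem_low {μ ν : ℕ × ℕ} (h : μ ≤ ν) {x : JordanPlane k}
    (hx : x - mon k μ ∈ low k μ) : ∃ r : JordanPlane k, r * x - mon k ν ∈ low k ν := by
  obtain ⟨a, b⟩ := μ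
  obtain ⟨c, d⟩ := ν
  obtain ⟨p, rfl⟩ := Nat.exists_eq_add_of_le (show a ≤ c from h.1)
  obtain ⟨q, rfl⟩ := Nat.exists_eq_add_of_le (show b ≤ d from h.2)
  have h₁ : u k ^ p * x - mon k (a + p, b) ∈ low k (a + p, b) := by
    clear h
    induction p with
    | zero => simpa using hx
    | succ p ih =>
      have := add_mem (u_mul_low ih) (Submodule.smul_mem _ (b : k)
        (mon_mem_low k (μ := (a + p + 1, b)) (ν := (a + p, b + 1))
          (Prod.Lex.toLex_lt_toLex.mpr (Or.inl (Nat.lt_succ_self _)))))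
      rw [mul_sub, u_mul_mon, ← mul_assoc, ← pow_succ'] at this
      convert this using 1
      simp only [add_assoc]; abel
  refine ⟨v k ^ q * u k ^ p, ?_⟩
  clear h
  induction q with
  | zero => simpa using h₁
  | succ q ih =>
    have := v_mul_low ih
    rw [mul_sub, v_mul_mon, ← mul_assoc, ← mul_assoc, ← pow_succ'] at this
    exact this

theorem exists_leading {s : Set (ℕ × ℕ)} {x : JordanPlane k}
    (hx : x ∈ Submodule.span k (mon k '' s)) (h0 : x ≠ 0) :
    ∃ ν ∈ s, ∃ c : k, c ≠ 0 ∧ c • x - mon k ν ∈ low k ν := by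
  rw [Finsupp.mem_span_image_iff_linearCombination] at hx
  obtain ⟨f, hf, rfl⟩ := hx
  have hf0 : f ≠ 0 := by rintro rfl; simp at h0
  obtain ⟨ν, hν, hmax⟩ := Finset.exists_max_image f.support toLex
    (Finsupp.support_nonempty_iff.mpr hf0)
  have hfν : f ν ≠ 0 := Finsupp.mem_support_iff.mp hν
  refine ⟨ν, hf hν, (f ν)⁻¹, inv_ne_zero hfν, ?_⟩
  rw [Finsupp.linearCombination_apply, Finsupp.sum, ← Finset.add_sum_erase _ _ hν, smul_add,
    smul_smul, inv_mul_cancel₀ hfν, one_smul, add_sub_cancel_left]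
  refine Submodule.smul_mem _ _ (Submodule.sum_mem _ fun i hi => Submodule.smul_mem _ _
    (mon_mem_low k (lt_of_le_of_ne (hmax i (Finset.mem_of_mem_erase hi)) fun h => ?_)))
  exact (Finset.ne_of_mem_erase hi) (toLex.injective h)

variable (k) in
theorem isNoetherianRing : IsNoetherianRing (JordanPlane k) := by
  refine (isNoetherianRing_iff_ideal_fg _).mpr fun I => ?_
  let L : Set (ℕ × ℕ) := {μ | ∃ x ∈ I, x - mon k μ ∈ low k μ}
  have hfin : {μ | Minimal (· ∈ L) μ}.Finite :=
    WellQuasiOrderedLE.finite_of_isAntichain (setOfPred_minimal_antichain _)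
  choose! g hgI hg using fun μ (hμ : μ ∈ L) => hμ
  have hle : Ideal.span (g '' {μ | Minimal (· ∈ L) μ}) ≤ I := by
    rw [Ideal.span_le]
    rintro _ ⟨μ, hμ, rfl⟩
    exact hgI μ hμ.prop
  refine ⟨(hfin.image g).toFinset, le_antisymm (by simpa using hle) ?_⟩
  rw [Set.Finite.coe_toFinset]
  have key : ∀ ν : ℕ ×ₗ ℕ, ∀ x ∈ I, ∀ c : k, c ≠ 0 →
      c • x - mon k (ofLex ν) ∈ low k (ofLex ν) →
      x ∈ Ideal.span (g '' {μ | Minimal (· ∈ L) μ}) := by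
    intro ν
    induction ν using WellFoundedLT.induction with
    | _ ν ih =>
    intro x hx c hc hν
    have smul_mem : ∀ (J : Ideal (JordanPlane k)) (c : k) (x), x ∈ J → c • x ∈ J :=
      fun J c x hx => by rw [Algebra.smul_def]; exact J.mul_mem_left _ hx
    have hL : ofLex ν ∈ L := ⟨c • x, smul_mem _ _ _ hx, hν⟩
    obtain ⟨μ, hμν, hμ⟩ := exists_minimal_le_of_wellFoundedLT (· ∈ L) _ hL
    obtain ⟨r, hr⟩ := exists_sub_mon_mem_low hμν (hg μ hμ.prop)
    have hy : r * g μ ∈ Ideal.span (g '' {μ | Minimal (· ∈ L) μ}) :=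
      Ideal.mul_mem_left _ _ (Ideal.subset_span ⟨μ, hμ, rfl⟩)
    have hd : c • x - r * g μ ∈ low k (ofLex ν) := by
      have := sub_mem hν hr
      rwa [sub_sub_sub_cancel_right] at this
    have hdI : c • x - r * g μ ∈ Ideal.span (g '' {μ | Minimal (· ∈ L) μ}) := by
      by_cases h0 : c • x - r * g μ = 0
      · rw [h0]; exact zero_mem _
      obtain ⟨ν', hν', c', hc', h'⟩ := exists_leading hd h0
      exact ih (toLex ν') hν' _ (sub_mem (smul_mem _ _ _ hx) (hle hy)) c' hc' h'
    have hcx := add_mem hdI hy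
    rw [sub_add_cancel] at hcx
    have := smul_mem _ c⁻¹ _ hcx
    rwa [smul_smul, inv_mul_cancel₀ hc, one_smul] at this
  intro x hx
  by_cases h0 : x = 0
  · rw [h0]; exact zero_mem _
  have hx' : x ∈ Submodule.span k (mon k '' Set.univ) := by
    rw [Set.image_univ, span_mon]; trivial
  obtain ⟨ν, -, c, hc, h⟩ := exists_leading hx' h0
  exact key (toLex ν) x hx c hc h

end JordanPlane

/-! ### Subalgebras containing a left ideal -/

section Killed

variable (k : Type*) [Field k] {R : Type*} [Ring R] [Algebra k R]

/-- The subspace of the elements of a module that are killed by a left ideal `T`. -/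
def killedBy (T : Ideal R) (N : Type*) [AddCommGroup N] [Module R N] [Module k N]
    [IsScalarTower k R N] : Submodule k N where
  carrier := {x | ∀ t ∈ T, t • x = 0}
  zero_mem' := fun t _ => smul_zero t
  add_mem' := fun hx hy t ht => by rw [smul_add, hx t ht, hy t ht, add_zero]
  smul_mem' := fun c x hx t ht => by
    rw [← algebraMap_smul R c x, smul_smul, ← Algebra.commutes, ← smul_smul, hx t ht, smul_zero]

variable {k}

theorem fg_killedBy_inf_span {R : Type u} [Ring R] [Algebra k R] {T : Ideal R}
    (h : ∀ (N : Type u) [AddCommGroup N] [Module R N] [Module k N] [IsScalarTower k R N],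
      ∀ y ∈ killedBy k T N,
        (killedBy k T N ⊓ (Submodule.span R {y}).restrictScalars k).FG) (n : ℕ) :
    ∀ (N : Type u) [AddCommGroup N] [Module R N] [Module k N] [IsScalarTower k R N] (l : List N),
      l.length = n → (∀ y ∈ l, y ∈ killedBy k T N) →
        (killedBy k T N ⊓ (Submodule.span R {y | y ∈ l}).restrictScalars k).FG := by
  induction n with
  | zero =>
    intro N _ _ _ _ l hl _
    obtain rfl := List.length_eq_zero_iff.mp hl
    have : (Submodule.span R {y : N | y ∈ []}).restrictScalars k = ⊥ := by simp
    rw [this, inf_bot_eq]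
    exact Submodule.fg_bot
  | succ n ih =>
    intro N _ _ _ _ l hl hkill
    obtain ⟨y, l, rfl⟩ := List.exists_cons_of_length_eq_add_one hl
    let P : Submodule R N := Submodule.span R {y}
    refine Submodule.fg_of_fg_map_of_fg_inf_ker (P.mkQ.restrictScalars k) ?_ ?_
    · refine Submodule.FG.of_le (ih (N ⧸ P) (l.map P.mkQ) (by simpa using hl) ?_) ?_
      · intro z hz
        obtain ⟨x, hx, rfl⟩ := List.mem_map.mp hz
        intro t ht
        rw [← map_smul, hkill x (List.mem_cons_of_mem _ hx) t ht, map_zero]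
      · rintro _ ⟨x, ⟨hx₁, hx₂⟩, rfl⟩
        refine ⟨fun t ht => ?_, ?_⟩
        · change t • P.mkQ x = 0
          rw [← map_smul, hx₁ t ht, map_zero]
        · change P.mkQ x ∈ Submodule.span R _
          have hx₃ : P.mkQ x ∈ (Submodule.span R {z | z ∈ y :: l}).map P.mkQ := ⟨x, hx₂, rfl⟩
          rw [Submodule.map_span] at hx₃
          refine Submodule.span_le.mpr ?_ hx₃
          rintro _ ⟨z, hz, rfl⟩
          obtain rfl | hz := List.mem_cons.mp hz
          · rw [show P.mkQ z = 0 from (Submodule.Quotient.mk_eq_zero P).mpr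
              (Submodule.mem_span_singleton_self z)]
            exact zero_mem _
          · exact Submodule.subset_span (List.mem_map_of_mem hz)
    · refine Submodule.FG.of_le (h N y (hkill y List.mem_cons_self)) ?_
      rintro x ⟨⟨hx₁, -⟩, hx₂⟩
      exact ⟨hx₁, (Submodule.Quotient.mk_eq_zero P).mp hx₂⟩

/-- A subalgebra `B` of a left noetherian algebra is left noetherian if it contains a left ideal
`T` such that the annihilator of `T` in every cyclic module killed by `T` on the generator is
finite-dimensional. -/
theorem isNoetherianRing_of_leftIdeal {R : Type u} [Ring R] [Algebra k R] [IsNoetherianRing R]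
    (B : Subalgebra k R) (T : Ideal R) (hT : ∀ t ∈ T, t ∈ B)
    (h : ∀ (N : Type u) [AddCommGroup N] [Module R N] [Module k N] [IsScalarTower k R N],
      ∀ y ∈ killedBy k T N,
        (killedBy k T N ⊓ (Submodule.span R {y}).restrictScalars k).FG) :
    IsNoetherianRing B := by
  classical
  refine (isNoetherianRing_iff_ideal_fg _).mpr fun I => ?_
  let I' : Submodule k R := (I.restrictScalars k).map B.val.toLinearMap
  have hI' : ∀ x, x ∈ I' → ∃ y ∈ I, (y : R) = x := fun x hx => hx
  let s : Set R := {z | ∃ t ∈ T, ∃ x ∈ I, z = t * (x : R)}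
  let K : Submodule R R := Submodule.span R s
  obtain ⟨G, hGs, hG⟩ := (Submodule.fg_span_iff_fg_span_finset_subset (R := R) s).mp
    (IsNoetherian.noetherian K)
  obtain ⟨Y, hYI, hY⟩ := (Submodule.fg_span_iff_fg_span_finset_subset (R := R) (I' : Set R)).mp
    (IsNoetherian.noetherian _)
  let q : R →ₗ[k] R ⧸ K := K.mkQ.restrictScalars k
  have hkill : ∀ x ∈ I', K.mkQ x ∈ killedBy k T (R ⧸ K) := by
    intro x hx t ht
    obtain ⟨y, hy, rfl⟩ := hI' x hx
    rw [← map_smul]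
    exact (Submodule.Quotient.mk_eq_zero K).mpr (Submodule.subset_span ⟨t, ht, y, hy, rfl⟩)
  have hfg : (I'.map q).FG := by
    refine Submodule.FG.of_le (fg_killedBy_inf_span h _ (R ⧸ K) (Y.toList.map K.mkQ) rfl ?_) ?_
    · intro z hz
      obtain ⟨x, hx, rfl⟩ := List.mem_map.mp hz
      exact hkill x (hYI (by simpa using hx))
    · rintro _ ⟨x, hx, rfl⟩
      refine ⟨hkill x hx, ?_⟩
      have hx' : x ∈ Submodule.span R (Y : Set R) := hY ▸ Submodule.subset_span hx
      have := Submodule.mem_map_of_mem (f := K.mkQ) hx'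
      rw [Submodule.map_span] at this
      refine Submodule.span_mono ?_ this
      rintro _ ⟨z, hz, rfl⟩
      exact List.mem_map_of_mem (by simpa using hz)
  obtain ⟨F, hFI, hF⟩ : ∃ F : Finset R, (F : Set R) ⊆ I' ∧
      I'.map q = Submodule.span k (q '' F) := by
    have hspan : I'.map q = Submodule.span k (q '' I') := by
      rw [← Submodule.map_span, Submodule.span_eq]
    rw [hspan] at hfg ⊢
    obtain ⟨F₀, hF₀, hF₀'⟩ := (Submodule.fg_span_iff_fg_span_finset_subset _).mp hfg
    obtain ⟨F, hF, rfl⟩ := Finset.subset_set_image_iff.mp hF₀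
    exact ⟨F, hF, by rw [hF₀', Finset.coe_image]⟩
  choose! gt hgt gx hgx hg using fun z (hz : z ∈ s) => hz
  choose! fx hfx hf using hI'
  let X : Finset B := F.image fx ∪ G.image gx
  have hXI : Ideal.span (X : Set B) ≤ I := by
    rw [Ideal.span_le]
    intro x hx
    simp only [X, Finset.coe_union, Finset.coe_image] at hx
    obtain ⟨z, hz, rfl⟩ | ⟨z, hz, rfl⟩ := hx
    · exact hfx z (hFI hz)
    · exact hgx z (hGs hz)
  refine ⟨X, le_antisymm hXI fun x hx => ?_⟩
  have hxq : q x ∈ Submodule.span k (q '' F) := hF ▸ ⟨(x : R), ⟨x, hx, rfl⟩, rfl⟩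
  rw [← Submodule.map_span] at hxq
  obtain ⟨z, hz, hzx⟩ := hxq
  have hFX : ∀ z ∈ Submodule.span k (F : Set R), ∃ y ∈ Ideal.span (X : Set B), (y : R) = z := by
    intro z hz
    induction hz using Submodule.span_induction with
    | zero => exact ⟨0, zero_mem _, rfl⟩
    | add a b _ _ ha hb =>
      obtain ⟨a', ha, rfl⟩ := ha
      obtain ⟨b', hb, rfl⟩ := hb
      exact ⟨a' + b', add_mem ha hb, rfl⟩
    | smul c a _ ha =>
      obtain ⟨a', ha, rfl⟩ := ha
      exact ⟨algebraMap k B c * a', Ideal.mul_mem_left _ _ ha, (Algebra.smul_def c (a' : R)).symm⟩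
    | mem a ha =>
      exact ⟨fx a, Ideal.subset_span (by simpa [X] using Or.inl ⟨a, ha, rfl⟩), hf a (hFI ha)⟩
  have hGX : ∀ z ∈ K, ∃ y ∈ Ideal.span (X : Set B), (y : R) = z := by
    intro z hz
    have hz' : z ∈ Submodule.span R (G : Set R) := hG ▸ hz
    obtain ⟨c, -, rfl⟩ := Submodule.mem_span_finset.mp hz'
    have hc : ∀ a ∈ G, c a * gt a ∈ B := fun a ha =>
      hT _ (Ideal.mul_mem_left _ _ (hgt a (hGs ha)))
    refine ⟨∑ a ∈ G.attach, ⟨c a * gt a, hc a a.2⟩ * gx a, Submodule.sum_mem _ fun a _ =>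
      Ideal.mul_mem_left _ _ (Ideal.subset_span (by
        simpa [X] using Or.inr ⟨a.1, a.2, rfl⟩)), ?_⟩
    rw [← Finset.sum_attach G, AddSubmonoidClass.coe_finsetSum]
    refine Finset.sum_congr rfl fun a _ => ?_
    change c a * gt a * (gx a : R) = c a * a.1
    rw [mul_assoc, ← hg a (hGs a.2)]
  obtain ⟨y₁, hy₁, rfl⟩ := hFX z hz
  have hxz : (x : R) - y₁ ∈ K := (Submodule.Quotient.eq K).mp hzx.symm
  obtain ⟨y₂, hy₂, hy⟩ := hGX _ hxz
  have : x = y₂ + y₁ := Subtype.ext (by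
    change (x : R) = y₂ + y₁
    rw [hy, sub_add_cancel])
  rw [this]
  exact add_mem hy₂ hy₁

end Killed

/-! ### The images of the maps `λ_a` -/

namespace JordanPlane

variable {k : Type*} [Field k]

theorem smul_mem_span_smul_mon {N : Type*} [AddCommGroup N] [Module (JordanPlane k) N] [Module k N]
    [IsScalarTower k (JordanPlane k) N] (y : N) :
    (Submodule.span (JordanPlane k) {y}).restrictScalars k
      ≤ Submodule.span k (Set.range fun p => mon k p • y) := by
  intro x hx
  obtain ⟨r, rfl⟩ := Submodule.mem_span_singleton.mp hx
  have hr : r ∈ Submodule.span k (Set.range (mon k)) := by rw [span_mon]; trivial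
  have := Submodule.mem_map_of_mem
    (f := (LinearMap.toSpanSingleton (JordanPlane k) N y).restrictScalars k) hr
  rw [Submodule.map_span, ← Set.range_comp] at this
  exact this

theorem fg_killedBy_span_u [CharZero k] {N : Type*} [AddCommGroup N] [Module (JordanPlane k) N]
    [Module k N] [IsScalarTower k (JordanPlane k) N] {y : N}
    (hy : y ∈ killedBy k (Ideal.span {u k}) N) :
    (killedBy k (Ideal.span {u k}) N ⊓
      (Submodule.span (JordanPlane k) {y}).restrictScalars k).FG := by
  have hu : ∀ x ∈ killedBy k (Ideal.span {u k}) N, u k • x = 0 :=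
    fun x hx => hx _ (Ideal.mem_span_singleton_self _)
  have hspan : (Submodule.span (JordanPlane k) {y}).restrictScalars k
      ≤ Submodule.span k (Set.range fun j : ℕ => v k ^ j • y) := by
    refine (smul_mem_span_smul_mon y).trans (Submodule.span_le.mpr ?_)
    rintro _ ⟨⟨i, j⟩, rfl⟩
    change (v k ^ j * u k ^ i) • y ∈ _
    rcases i with _ | i
    · rw [pow_zero, mul_one]; exact Submodule.subset_span ⟨j, rfl⟩
    · rw [pow_succ, ← mul_assoc, mul_smul, hu y hy, smul_zero]; exact zero_mem _
  have huv : ∀ j : ℕ, u k • v k ^ j • y = (j : k) • v k ^ (j + 1) • y := by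
    intro j
    rw [smul_smul, u_mul_v_pow, add_smul, mul_smul, hu y hy, smul_zero, zero_add, smul_assoc]
  by_cases hli : LinearIndependent k fun j : ℕ => v k ^ j • y
  · refine Submodule.FG.of_le (Submodule.fg_span_singleton y) ?_
    rintro x ⟨hx₁, hx₂⟩
    obtain ⟨c, rfl⟩ := Finsupp.mem_span_range_iff_exists_finsupp.mp (hspan hx₂)
    have h0 := hu _ hx₁
    rw [Finsupp.sum, Finset.smul_sum] at h0
    have h1 : ∑ j ∈ c.support, (c j * j) • v k ^ (j + 1) • y = 0 := by
      rw [← h0]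
      refine Finset.sum_congr rfl fun j _ => ?_
      rw [← algebraMap_smul (JordanPlane k) (c j) (v k ^ j • y), smul_smul (u k),
        ← Algebra.commutes, mul_smul (algebraMap k _ _), huv, algebraMap_smul, mul_smul]
    have h2 := linearIndependent_iff'.mp (hli.comp (· + 1) (add_left_injective 1)) _ _ h1
    refine Submodule.sum_mem _ fun j hj => ?_
    rcases j with _ | j
    · simpa using Submodule.smul_mem _ (c 0) (Submodule.mem_span_singleton_self y)
    · have := h2 _ hj
      rw [mul_eq_zero] at this
      exact absurd this (not_or.mpr
        ⟨Finsupp.mem_support_iff.mp hj, Nat.cast_ne_zero.mpr (Nat.succ_ne_zero j)⟩)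
  · rw [linearIndependent_iff] at hli
    push Not at hli
    obtain ⟨c, hc, hc0⟩ := hli
    obtain ⟨d, hd, hmax⟩ := Finset.exists_max_image c.support id
      (Finsupp.support_nonempty_iff.mpr hc0)
    have hcd : c d ≠ 0 := Finsupp.mem_support_iff.mp hd
    let V : Submodule k N := Submodule.span k ((fun j : ℕ => v k ^ j • y) '' {j | j < d})
    have hV : ∀ j < d, v k ^ j • y ∈ V := fun j hj => Submodule.subset_span ⟨j, hj, rfl⟩
    have hVd : v k ^ d • y ∈ V := by
      rw [Finsupp.linearCombination_apply, Finsupp.sum, ← Finset.add_sum_erase _ _ hd] at hc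
      have : v k ^ d • y
          = -((c d)⁻¹ • ∑ j ∈ c.support.erase d, c j • v k ^ j • y) := by
        rw [eq_neg_iff_add_eq_zero, ← smul_eq_zero_iff_right hcd, smul_add, smul_smul,
          mul_inv_cancel₀ hcd, one_smul, hc]
      rw [this]
      exact neg_mem (Submodule.smul_mem _ _ (Submodule.sum_mem _ fun j hj =>
        Submodule.smul_mem _ _ (hV j (lt_of_le_of_ne (hmax j (Finset.mem_of_mem_erase hj))
          (Finset.ne_of_mem_erase hj)))))
    have hVv : ∀ x ∈ V, v k • x ∈ V := by
      intro x hx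
      induction hx using Submodule.span_induction with
      | zero => simp
      | add x z _ _ hx hz => rw [smul_add]; exact add_mem hx hz
      | smul c x _ hx =>
        rw [← algebraMap_smul (JordanPlane k) c x, smul_smul, ← Algebra.commutes, mul_smul,
          algebraMap_smul]
        exact Submodule.smul_mem _ c hx
      | mem x hx =>
        obtain ⟨j, hj, rfl⟩ := hx
        change v k • v k ^ j • y ∈ V
        rw [smul_smul, ← pow_succ']
        obtain h | h : j + 1 < d ∨ j + 1 = d := by
          have : j < d := hj
          omega
        · exact hV _ h
        · rw [h]; exact hVd
    have hVall : ∀ j, v k ^ j • y ∈ V := by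
      intro j
      induction j with
      | zero =>
        rcases Nat.eq_zero_or_pos d with rfl | h
        · exact hVd
        · exact hV 0 h
      | succ j ih => rw [pow_succ', mul_smul]; exact hVv _ ih
    refine Submodule.FG.of_le (T := V)
      (Submodule.fg_span ((Set.finite_lt_nat d).image _)) (inf_le_right.trans (hspan.trans ?_))
    rw [Submodule.span_le]
    rintro _ ⟨j, rfl⟩
    exact hVall j

variable (k) in
/-- The left ideal `R_{≥ n}`. -/
noncomputable def idealGE (n : ℕ) : Ideal (JordanPlane k) :=
  { gradedPartGE k n with
    smul_mem' := by
      have h : ∀ g ∈ ({u k, v k} : Set (JordanPlane k)), ∀ x ∈ gradedPartGE k n,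
          g * x ∈ gradedPartGE k n := by
        intro g hg x hx
        have hle : gradedPartGE k n ≤ (gradedPartGE k n).comap (LinearMap.mulLeft k g) := by
          refine iSup₂_le fun m hm x hx => ?_
          refine le_iSup₂_of_le (f := fun m (_ : m ≥ n) => gradedPart k m) (m + 1)
            (Nat.le_succ_of_le hm) le_rfl ?_
          rw [gradedPart, pow_succ']
          exact Submodule.mul_mem_mul (Submodule.subset_span hg) hx
        exact hle hx
      exact fun r x hx => mul_mem_of_gen (h _ (by simp)) (h _ (by simp)) r x hx }

theorem mon_mem_idealGE {n i j : ℕ} (h : n ≤ i + j) : mon k (i, j) ∈ idealGE k n := by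
  have hm : mon k (i, j) ∈ gradedPart k (i + j) := by
    rw [gradedPart, add_comm, pow_add]
    exact Submodule.mul_mem_mul (Submodule.pow_mem_pow _ (Submodule.subset_span (by simp)) _)
      (Submodule.pow_mem_pow _ (Submodule.subset_span (by simp)) _)
  exact le_iSup₂_of_le (f := fun m (_ : m ≥ n) => gradedPart k m) (i + j) h le_rfl hm

theorem fg_killedBy_idealGE (n : ℕ) {N : Type*} [AddCommGroup N] [Module (JordanPlane k) N]
    [Module k N] [IsScalarTower k (JordanPlane k) N] {y : N}
    (hy : y ∈ killedBy k (idealGE k n) N) :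
    (killedBy k (idealGE k n) N ⊓
      (Submodule.span (JordanPlane k) {y}).restrictScalars k).FG := by
  refine Submodule.FG.of_le (T := Submodule.span k
      ((fun p => mon k p • y) '' (Finset.range n ×ˢ Finset.range n : Finset (ℕ × ℕ))))
    (Submodule.fg_span (Set.Finite.image _ (Finset.finite_toSet _)))
    (inf_le_right.trans ((smul_mem_span_smul_mon y).trans (Submodule.span_le.mpr ?_)))
  rintro _ ⟨⟨i, j⟩, rfl⟩
  by_cases h : n ≤ i + j
  · change mon k (i, j) • y ∈ _
    rw [hy _ (mon_mem_idealGE h)]; exact zero_mem _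
  · exact Submodule.subset_span ⟨(i, j), by simp; omega, rfl⟩

theorem gradedPart_le_span (n : ℕ) :
    gradedPart k n ≤ Submodule.span k {x | ∃ i j, i + j = n ∧ x = u k ^ i * v k ^ j} := by
  induction n with
  | zero =>
    rw [gradedPart, pow_zero, Submodule.one_le]
    exact Submodule.subset_span ⟨0, 0, rfl, by simp⟩
  | succ n ih =>
    rw [gradedPart, pow_succ, ← gradedPart]
    refine (mul_le_mul' ih le_rfl).trans ?_
    rw [Submodule.span_mul_span, Submodule.span_le]
    rintro _ ⟨_, ⟨i, j, hij, rfl⟩, g, hg, rfl⟩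
    obtain rfl | rfl := hg
    · change u k ^ i * v k ^ j * u k ∈ _
      rw [mul_assoc, v_pow_mul_u, mul_sub, ← mul_assoc, ← pow_succ, mul_smul_comm]
      exact sub_mem (Submodule.subset_span ⟨i + 1, j, by omega, rfl⟩)
        (Submodule.smul_mem _ _ (Submodule.subset_span ⟨i, j + 1, by omega, rfl⟩))
    · change u k ^ i * v k ^ j * v k ∈ _
      rw [mul_assoc, ← pow_succ]
      exact Submodule.subset_span ⟨i, j + 1, by omega, rfl⟩

variable (k) in
theorem span_u_pow_mul_v_pow :
    Submodule.span k (Set.range fun p : ℕ × ℕ => u k ^ p.1 * v k ^ p.2) = ⊤ := by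
  set N := Submodule.span k (Set.range fun p : ℕ × ℕ => u k ^ p.1 * v k ^ p.2)
  have hm : ∀ i j, u k ^ i * v k ^ j ∈ N := fun i j => Submodule.subset_span ⟨(i, j), rfl⟩
  have hgen : ∀ g : JordanPlane k, (∀ i j, u k ^ i * v k ^ j * g ∈ N) → ∀ x ∈ N, x * g ∈ N := by
    intro g hg x hx
    induction hx using Submodule.span_induction with
    | zero => simp
    | add x y _ _ hx hy => rw [add_mul]; exact add_mem hx hy
    | smul c x _ hx => rw [smul_mul_assoc]; exact Submodule.smul_mem _ c hx
    | mem x hx => obtain ⟨⟨i, j⟩, rfl⟩ := hx; exact hg i j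
  refine eq_top_iff.mpr fun r _ => ?_
  have := mul_mem_of_gen_right (hgen _ fun i j => ?_) (hgen _ fun i j => ?_) r 1
    (by simpa using hm 0 0)
  · rwa [one_mul] at this
  · rw [mul_assoc, v_pow_mul_u, mul_sub, ← mul_assoc, ← pow_succ, mul_smul_comm]
    exact sub_mem (hm _ _) (Submodule.smul_mem _ _ (hm _ _))
  · rw [mul_assoc, ← pow_succ]
    exact hm _ _

end JordanPlane

namespace UWittPos

open JordanPlane (u v)

variable {k : Type*} [Field k]

theorem lam_gen_zero (a : k) : lam a (gen k 0) = u k := by rw [lam_gen]; simp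

theorem lam_zero_gen (i : ℕ) : lam (0 : k) (gen k i) = u k * v k ^ i := by rw [lam_gen]; simp

theorem lam_one_gen (i : ℕ) : lam (1 : k) (gen k i) = v k ^ i * u k := by
  rw [lam_gen, JordanPlane.v_pow_mul_u, mul_one, sub_mul, smul_mul_assoc, ← pow_succ']

variable (k)

theorem range_lam_zero : ((lam (0 : k)).range : Set (JordanPlane k)) =
    {x | ∃ (c : k) (r : JordanPlane k), x = algebraMap k (JordanPlane k) c + u k * r} := by
  ext x
  constructor
  · rintro ⟨y, rfl⟩
    let N : Submodule k (JordanPlane k) :=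
      Submodule.span k {1} ⊔ LinearMap.range (LinearMap.mulLeft k (u k))
    have h := map_mem_of_mul_mem (lam (0 : k)) (N := N)
      (Submodule.mem_sup_left (Submodule.mem_span_singleton_self 1)) (fun m y _ =>
        Submodule.mem_sup_right ⟨v k ^ m * y, by
          rw [lam_zero_gen, mul_assoc]; rfl⟩) y
    obtain ⟨_, h₁, _, ⟨r, rfl⟩, h⟩ := Submodule.mem_sup.mp h
    obtain ⟨c, rfl⟩ := Submodule.mem_span_singleton.mp h₁
    exact ⟨c, r, by rw [Algebra.algebraMap_eq_smul_one]; exact h.symm⟩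
  · rintro ⟨c, r, rfl⟩
    refine add_mem (Subalgebra.algebraMap_mem _ c) ?_
    have hr : r ∈ Submodule.span k (Set.range fun p : ℕ × ℕ => u k ^ p.1 * v k ^ p.2) := by
      rw [JordanPlane.span_u_pow_mul_v_pow]; trivial
    induction hr using Submodule.span_induction with
    | zero => rw [mul_zero]; exact zero_mem _
    | add x y _ _ hx hy => rw [mul_add]; exact add_mem hx hy
    | smul c x _ hx => rw [mul_smul_comm]; exact Subalgebra.smul_mem _ hx c
    | mem x hx =>
      obtain ⟨⟨i, j⟩, rfl⟩ := hx
      refine ⟨gen k 0 ^ i * gen k j, ?_⟩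
      change lam (0 : k) (gen k 0 ^ i * gen k j) = u k * (u k ^ i * v k ^ j)
      rw [map_mul, map_pow, lam_gen_zero, lam_zero_gen, ← mul_assoc, ← mul_assoc, ← pow_succ,
        ← pow_succ']

theorem range_lam_one : ((lam (1 : k)).range : Set (JordanPlane k)) =
    {x | ∃ (c : k) (r : JordanPlane k), x = algebraMap k (JordanPlane k) c + r * u k} := by
  ext x
  constructor
  · rintro ⟨y, rfl⟩
    let N : Submodule k (JordanPlane k) :=
      Submodule.span k {1} ⊔ LinearMap.range (LinearMap.mulRight k (u k))
    have h := map_mem_of_mul_mem (lam (1 : k)) (N := N)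
      (Submodule.mem_sup_left (Submodule.mem_span_singleton_self 1)) (fun m y hy => by
        obtain ⟨_, h₁, _, ⟨r, rfl⟩, rfl⟩ := Submodule.mem_sup.mp hy
        obtain ⟨c, rfl⟩ := Submodule.mem_span_singleton.mp h₁
        refine Submodule.mem_sup_right ⟨c • v k ^ m + v k ^ m * u k * r, ?_⟩
        rw [lam_one_gen, mul_add, mul_smul_comm, mul_one, LinearMap.mulRight_apply,
          LinearMap.mulRight_apply, add_mul, smul_mul_assoc, mul_assoc (v k ^ m * u k)]) y
    obtain ⟨_, h₁, _, ⟨r, rfl⟩, h⟩ := Submodule.mem_sup.mp h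
    obtain ⟨c, rfl⟩ := Submodule.mem_span_singleton.mp h₁
    exact ⟨c, r, by rw [Algebra.algebraMap_eq_smul_one]; exact h.symm⟩
  · rintro ⟨c, r, rfl⟩
    refine add_mem (Subalgebra.algebraMap_mem _ c) ?_
    have hr : r ∈ Submodule.span k (Set.range (JordanPlane.mon k)) := by
      rw [JordanPlane.span_mon]; trivial
    induction hr using Submodule.span_induction with
    | zero => rw [zero_mul]; exact zero_mem _
    | add x y _ _ hx hy => rw [add_mul]; exact add_mem hx hy
    | smul c x _ hx => rw [smul_mul_assoc]; exact Subalgebra.smul_mem _ hx c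
    | mem x hx =>
      obtain ⟨⟨i, j⟩, rfl⟩ := hx
      refine ⟨gen k j * gen k 0 ^ i, ?_⟩
      change lam (1 : k) (gen k j * gen k 0 ^ i) = v k ^ j * u k ^ i * u k
      rw [map_mul, map_pow, lam_gen_zero, lam_one_gen, mul_assoc, mul_assoc, ← pow_succ,
        ← pow_succ']

variable {k}

theorem range_lam_eq_adjoin (a : k) :
    (lam a).range = Algebra.adjoin k (Set.range fun i => lam a (gen k i)) := by
  rw [← Algebra.map_top, ← adjoin_gen, AlgHom.map_adjoin, ← Set.range_comp]
  rfl

theorem mem_gradedPart (l : List ℕ+) {d : ℕ} (h : (l.map fun n => (n : ℕ)).sum = d) :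
    (l.map (e k)).prod ∈ gradedPart k d :=
  Submodule.subset_span ⟨l, h, rfl⟩

variable [CharZero k]

theorem gradedPartGE_le_range {a : k} (h0 : a ≠ 0) (h1 : a ≠ 1) :
    JordanPlane.gradedPartGE k 4 ≤ Subalgebra.toSubmodule (lam a).range := by
  have hβ : a ^ 2 - a ≠ 0 := by
    rw [sq, ← mul_sub_one]; exact mul_ne_zero h0 (sub_ne_zero.mpr h1)
  have hmon : ∀ i j, 4 ≤ i + j → u k ^ i * v k ^ j ∈ (lam a).range := by
    intro i
    induction i with
    | zero =>
      intro j hj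
      obtain ⟨t, rfl⟩ : ∃ t, j = t + 4 := ⟨j - 4, by omega⟩
      refine ⟨(a ^ 2 - a)⁻¹ • quadZ k (gen k) t, ?_⟩
      change lam a _ = _
      rw [map_smul, lam_quadZ, smul_smul, inv_mul_cancel₀ hβ, one_smul, pow_zero, one_mul]
    | succ i ih =>
      intro j hj
      have h : u k ^ (i + 1) * v k ^ j
          = lam a (gen k 0 ^ i * gen k j) + ((j : k) * a) • (u k ^ i * v k ^ (j + 1)) := by
        rw [map_mul, map_pow, lam_gen_zero, lam_gen, sub_mul, smul_mul_assoc, ← pow_succ', mul_sub,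
          mul_smul_comm, sub_add_cancel, ← mul_assoc, ← pow_succ]
      rw [h]
      exact add_mem ⟨_, rfl⟩ (Subalgebra.smul_mem _ (ih (j + 1) (by omega)) _)
  refine iSup₂_le fun m hm => (JordanPlane.gradedPart_le_span m).trans (Submodule.span_le.mpr ?_)
  rintro _ ⟨i, j, hij, rfl⟩
  exact hmon i j (by omega)

theorem isNoetherianRing_range_lam (a : k) : IsNoetherianRing (lam a).range := by
  have := JordanPlane.isNoetherianRing k
  have h1 : IsNoetherianRing (lam (1 : k)).range := by
    refine isNoetherianRing_of_leftIdeal _ (Ideal.span {u k}) (fun t ht => ?_)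
      fun N _ _ _ _ y hy => JordanPlane.fg_killedBy_span_u hy
    obtain ⟨r, rfl⟩ := Ideal.mem_span_singleton'.mp ht
    rw [← SetLike.mem_coe, range_lam_one]
    exact ⟨0, r, by simp⟩
  rcases eq_or_ne a 1 with rfl | ha1
  · exact h1
  rcases eq_or_ne a 0 with rfl | ha0
  · have hker : RingHom.ker (lam (1 : k)).rangeRestrict.toRingHom
        ≤ RingHom.ker (lam (0 : k)).rangeRestrict.toRingHom := by
      intro x hx
      have hx₁ : x ∈ TwoSidedIdeal.ker (lam (1 : k)) :=
        (TwoSidedIdeal.mem_ker _).mpr (congrArg Subtype.val hx)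
      rw [ker_lam_special (Or.inr rfl), ← ker_lam_special (Or.inl rfl)] at hx₁
      exact Subtype.ext ((TwoSidedIdeal.mem_ker _).mp hx₁)
    have hs : Function.Surjective (lam (1 : k)).rangeRestrict.toRingHom :=
      AlgHom.rangeRestrict_surjective _
    refine isNoetherianRing_of_surjective _ _
      (RingHom.liftOfSurjective _ hs ⟨_, hker⟩) fun y => ?_
    obtain ⟨x, rfl⟩ := (lam (0 : k)).rangeRestrict_surjective y
    exact ⟨(lam (1 : k)).rangeRestrict x,
      RingHom.liftOfRightInverse_comp_apply _ _ (Function.rightInverse_surjInv hs) ⟨_, hker⟩ x⟩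
  · exact isNoetherianRing_of_leftIdeal _ (JordanPlane.idealGE k 4)
      (fun t ht => gradedPartGE_le_range ha0 ha1 ht)
      fun N _ _ _ _ y hy => JordanPlane.fg_killedBy_idealGE 4 hy

theorem isNoetherianRing_range_lam_op (a : k) : IsNoetherianRing ((lam a).range)ᵐᵒᵖ := by
  let τ : JordanPlane k →ₐ[k] (JordanPlane k)ᵐᵒᵖ :=
    JordanPlane.lift (MulOpposite.op (-u k)) (MulOpposite.op (v k)) (by
      rw [← MulOpposite.op_mul, ← MulOpposite.op_mul, ← MulOpposite.op_pow, ← MulOpposite.op_sub,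
        ← MulOpposite.op_sub, MulOpposite.op_eq_zero_iff, ← JordanPlane.rel_uv k]
      noncomm_ring)
  have hτ : ∀ i, τ (lam (1 - a) (gen k i)) = -MulOpposite.op (lam a (gen k i)) := by
    intro i
    rw [lam_gen, lam_gen, map_mul, map_sub, map_smul, map_pow, JordanPlane.lift_u,
      JordanPlane.lift_v, ← MulOpposite.op_pow, ← MulOpposite.op_smul, ← MulOpposite.op_sub,
      ← MulOpposite.op_mul, ← MulOpposite.op_neg, mul_sub, mul_neg, JordanPlane.v_pow_mul_u,
      mul_smul_comm, ← pow_succ, sub_mul, smul_mul_assoc, ← pow_succ']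
    congr 1
    module
  have hmap : (lam (1 - a)).range.map τ = (lam a).range.op := by
    rw [range_lam_eq_adjoin, range_lam_eq_adjoin, Subalgebra.op_adjoin, AlgHom.map_adjoin]
    apply le_antisymm
    · rw [Algebra.adjoin_le_iff]
      rintro _ ⟨_, ⟨i, rfl⟩, rfl⟩
      rw [SetLike.mem_coe]
      dsimp only
      rw [hτ]
      exact neg_mem (Algebra.subset_adjoin ⟨i, rfl⟩)
    · rw [Algebra.adjoin_le_iff]
      rintro x ⟨i, hi⟩
      have : x = -τ (lam (1 - a) (gen k i)) := by
        rw [hτ, neg_neg]; exact MulOpposite.unop_injective hi.symm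
      rw [this]
      exact neg_mem (Algebra.subset_adjoin ⟨_, ⟨i, rfl⟩, rfl⟩)
  have := isNoetherianRing_range_lam (1 - a)
  have h₁ : IsNoetherianRing (lam a).range.op := by
    rw [← hmap]
    refine isNoetherianRing_of_surjective (lam (1 - a)).range _
      ((τ.comp (lam (1 - a)).range.val).codRestrict ((lam (1 - a)).range.map τ)
        fun x => ⟨x, x.2, rfl⟩).toRingHom ?_
    rintro ⟨_, x, hx, rfl⟩
    exact ⟨⟨x, hx⟩, rfl⟩
  exact isNoetherianRing_of_ringEquiv _
    ((RingEquiv.opOp _).trans (RingEquiv.op (lam a).range.algEquivOpMop.toRingEquiv.symm))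

end UWittPos

/-! ### Homogeneity of the generators of the kernels -/

namespace UWittPos

variable {k : Type*} [Field k]

theorem h₁_mem_gradedPart (a : k) : h₁ a ∈ gradedPart k 5 := by
  have m₁ := mem_gradedPart (k := k) [1, 2, 2] (d := 5) rfl
  have m₂ := mem_gradedPart (k := k) [1, 1, 3] (d := 5) rfl
  have m₃ := mem_gradedPart (k := k) [2, 3] (d := 5) rfl
  have m₄ := mem_gradedPart (k := k) [1, 4] (d := 5) rfl
  have m₅ := mem_gradedPart (k := k) [5] (d := 5) rfl
  simp only [List.map_cons, List.map_nil, List.prod_cons, List.prod_nil, mul_one] at *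
  rw [h₁, sq, sq, mul_assoc (e k 1) (e k 1)]
  exact sub_mem (add_mem (sub_mem (sub_mem m₁ m₂) (Submodule.smul_mem _ _ m₃))
    (Submodule.smul_mem _ _ m₄)) (Submodule.smul_mem _ _ m₅)

theorem ofNat_mul_mem {N : Submodule k (UWittPos k)} (n : ℕ) [n.AtLeastTwo] {x : UWittPos k}
    (hx : x ∈ N) : (OfNat.ofNat n : UWittPos k) * x ∈ N := by
  have : (OfNat.ofNat n : UWittPos k) * x = (OfNat.ofNat n : k) • x := by
    rw [Algebra.smul_def, map_ofNat]
  rw [this]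
  exact N.smul_mem _ hx

variable (k) in
theorem h₂_mem_gradedPart : h₂ k ∈ gradedPart k 6 := by
  have m₁ := mem_gradedPart (k := k) [1, 5] (d := 6) rfl
  have m₂ := mem_gradedPart (k := k) [2, 4] (d := 6) rfl
  have m₃ := mem_gradedPart (k := k) [3, 3] (d := 6) rfl
  have m₄ := mem_gradedPart (k := k) [6] (d := 6) rfl
  simp only [List.map_cons, List.map_nil, List.prod_cons, List.prod_nil, mul_one] at *
  rw [h₂, sq]
  exact add_mem (add_mem (sub_mem m₁ (ofNat_mul_mem 4 m₂)) (ofNat_mul_mem 3 m₃))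
    (ofNat_mul_mem 2 m₄)

theorem h₃_mem_gradedPart (a : k) : h₃ a ∈ gradedPart k 6 := by
  have m₁ := mem_gradedPart (k := k) [1, 1, 2, 2] (d := 6) rfl
  have m₂ := mem_gradedPart (k := k) [2, 2, 2] (d := 6) rfl
  have m₃ := mem_gradedPart (k := k) [1, 1, 1, 3] (d := 6) rfl
  have m₄ := mem_gradedPart (k := k) [3, 3] (d := 6) rfl
  have m₅ := mem_gradedPart (k := k) [1, 5] (d := 6) rfl
  have m₆ := mem_gradedPart (k := k) [6] (d := 6) rfl
  simp only [List.map_cons, List.map_nil, List.prod_cons, List.prod_nil, mul_one] at *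
  rw [h₃]
  simp only [pow_succ, pow_zero, one_mul, mul_assoc]
  exact add_mem (sub_mem (add_mem (add_mem (sub_mem (neg_mem (ofNat_mul_mem 4 m₁))
    (ofNat_mul_mem 4 m₂)) (ofNat_mul_mem 4 m₃)) (Submodule.smul_mem _ _ m₄))
    (Submodule.smul_mem _ _ m₅)) (Submodule.smul_mem _ _ m₆)

end UWittPos

theorem theorem0p4 (k : Type*) [Field k] [CharZero k] :
    -- (a) the kernel of `λ_a`
    (∀ a : k, a = 0 ∨ a = 1 →
      TwoSidedIdeal.ker (UWittPos.lam a) =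
        TwoSidedIdeal.span
          {UWittPos.e k 1 * UWittPos.e k 3 - UWittPos.e k 2 ^ 2 - UWittPos.e k 4}) ∧
    (∀ a : k, a ≠ 0 → a ≠ 1 →
      UWittPos.h₁ a ∈ UWittPos.gradedPart k 5 ∧
      UWittPos.h₂ k ∈ UWittPos.gradedPart k 6 ∧
      UWittPos.h₃ a ∈ UWittPos.gradedPart k 6 ∧
      TwoSidedIdeal.ker (UWittPos.lam a) =
        TwoSidedIdeal.span {UWittPos.h₁ a, UWittPos.h₂ k, UWittPos.h₃ a}) ∧
    -- (b) the image of `λ_a`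
    (((UWittPos.lam (0 : k)).range : Set (JordanPlane k)) =
      {x | ∃ (c : k) (r : JordanPlane k),
        x = algebraMap k (JordanPlane k) c + JordanPlane.u k * r}) ∧
    (((UWittPos.lam (1 : k)).range : Set (JordanPlane k)) =
      {x | ∃ (c : k) (r : JordanPlane k),
        x = algebraMap k (JordanPlane k) c + r * JordanPlane.u k}) ∧
    (∀ a : k, a ≠ 0 → a ≠ 1 →
      JordanPlane.gradedPartGE k 4 ≤ Subalgebra.toSubmodule (UWittPos.lam a).range) ∧
    (∀ a : k, IsNoetherianRing (UWittPos.lam a).range ∧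
      IsNoetherianRing ((UWittPos.lam a).range)ᵐᵒᵖ) ∧
    -- (c) the kernel of `φ`
    TwoSidedIdeal.ker (UWittPos.phi k) =
      TwoSidedIdeal.span
        {UWittPos.e k 1 * UWittPos.e k 5 - 4 * (UWittPos.e k 2 * UWittPos.e k 4)
          + 3 * UWittPos.e k 3 ^ 2 + 2 * UWittPos.e k 6} := by
  refine ⟨fun a ha => UWittPos.ker_lam_special ha, fun a h0 h1 => ⟨?_, ?_, ?_,
    UWittPos.ker_lam_generic h0 h1⟩, UWittPos.range_lam_zero k, UWittPos.range_lam_one k,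
    fun a h0 h1 => UWittPos.gradedPartGE_le_range h0 h1,
    fun a => ⟨UWittPos.isNoetherianRing_range_lam a, UWittPos.isNoetherianRing_range_lam_op a⟩,
    UWittPos.ker_phi k⟩
  · exact UWittPos.h₁_mem_gradedPart a
  · exact UWittPos.h₂_mem_gradedPart k
  · exact UWittPos.h₃_mem_gradedPart a
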